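/- Let $\Gamma$ be a countable discrete group and let $\Sigma=(\sigma_i\colon\Gamma\to S_{d_i})_{i\ge 1}$ be a sofic approximation of $\Gamma$: writing $u_d$ for the uniform probability measure on $\{1,\dots,d\}$, \[\lim_{i\to\infty} u_{d_i}(\{k:\sigma_i(g)\sigma_i(h)(k)=\sigma_i(gh)(k)\})=1\ \text{ for all } g,h\in\Gamma,\qquad \lim_{i\to\infty} u_{d_i}(\{k:\sigma_i(g)(k)\neq\sigma_i(h)(k)\})=1\ \text{ for all } g\neq h \text{ in } \Gamma.\] Entropy. Let $\Gamma\curvearrowright(Y,\nu)$ be a measure-preserving action on a standard probability space. A finite observable is a measurable map from $Y$ to a finite set. For a finite observable $\beta\colon Y\to B$, a finite $F\subseteq\Gamma$ containing the identity $e$, $\delta>0$ and $\sigma\colon\Gamma\to S_d$, let $\widetilde\beta^F\colon Y\to B^F$ be $\widetilde\beta^F(y)(g)=\beta(g^{-1}y)$, and let $\mathrm{AP}(\beta,F,\delta,\sigma)$ be the set of all $\phi\colon\{1,\dots,d\}\to B^F$ with \[\sum_{a\in B^F}\bigl|u_d(\phi^{-1}(\{a\}))-\nu((\widetilde\beta^F)^{-1}(\{a\}))\bigr|<\delta,\qquad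 u_d(\{j:\phi(j)(g)\neq\phi(\sigma(g)^{-1}(j))(e)\})<\delta\ \text{ for all } g\in F.\] The sofic entropy of the action with respect to $\Sigma$ is \[h_{\Sigma,\nu}(Y,\Gamma)=\sup_{\alpha}\ \inf_{\beta,\pi}\ \inf_{F,\delta}\ \limsup_{i\to\infty}\frac{1}{d_i}\log\bigl|\{\,j\mapsto\pi(\phi(j)(e)) : \phi\in\mathrm{AP}(\beta,F,\delta,\sigma_i)\}\bigr|\in[-\infty,\infty],\] where $\log 0=-\infty$, $\alpha\colon Y\to A$ runs over all finite observables, $\beta\colon Y\to B$ over all finite observables that refine $\alpha$ through a map $\pi\colon B\to A$ (that is, $\pi\circ\beta=\alpha$ almost everywhere), $F$ over the finite subsets of $\Gamma$ containing $e$, and $\delta$ over the positive reals. Statement. Let $\Gamma\curvearrowright(X,\mu)$ be a measure-preserving action on a standard probability space that has completely positive entropy with respect to $\Sigma$: whenever a measure-preserving action $\Gamma\curvearrowright(Y,\nu)$ on a standard probability space is a factor of $\Gamma\curvearrowright(X,\mu)$ (there is a measure-preserving, almost everywhere $\Gamma$-equivariant map $X\to Y$) and $(Y,\nu)$ is not a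 one-atom space, then $h_{\Sigma,\nu}(Y,\Gamma)>0$. Then the Koopman representation $\rho^0$ of $\Gamma$ on $L^2(X,\mu)\ominus\mathbb{C}1$, given by $(\rho^0(g)\xi)(x)=\xi(g^{-1}x)$, embeds into the countably infinite direct sum $\lambda_\Gamma^{\oplus\mathbb{N}}$ of the left regular representation $(\lambda_\Gamma(g)f)(x)=f(g^{-1}x)$ on $\ell^2(\Gamma)$; that is, there is a $\Gamma$-equivariant linear isometry from $L^2(X,\mu)\ominus\mathbb{C}1$ into $\ell^2(\Gamma)^{\oplus\mathbb{N}}$. -/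

import Mathlib

open MeasureTheory Filter Topology
open scoped ENNReal

/-! ## Unitary representations -/

/-- A unitary representation of the (discrete) group `Γ` on `H`. -/
abbrev UnitaryRep (Γ H : Type*) [Group Γ] [NormedAddCommGroup H] [InnerProductSpace ℂ H] :=
  Γ →* (H ≃ₗᵢ[ℂ] H)

namespace UnitaryRep

/-- A family of linear isometries `U g` with `U 1 = id` and `U (g * h) = U g ∘ U h` is a
unitary representation. -/
noncomputable def ofIsometries {Γ H : Type*} [Group Γ] [NormedAddCommGroup H]
    [InnerProductSpace ℂ H] (U : Γ → (H →ₗᵢ[ℂ] H)) (h1 : ∀ x, U 1 x = x)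
    (hmul : ∀ g h x, U (g * h) x = U g (U h x)) : UnitaryRep Γ H where
  toFun g :=
    { (U g).toLinearMap with
      invFun := U g⁻¹
      left_inv := fun x => by
        change U g⁻¹ (U g x) = x
        rw [← hmul, inv_mul_cancel, h1]
      right_inv := fun x => by
        change U g (U g⁻¹ x) = x
        rw [← hmul, mul_inv_cancel, h1]
      norm_map' := (U g).norm_map }
  map_one' := LinearIsometryEquiv.ext h1
  map_mul' g h := LinearIsometryEquiv.ext (hmul g h)

theorem ofIsometries_apply {Γ H : Type*} [Group Γ] [NormedAddCommGroup H]
    [InnerProductSpace ℂ H] (U : Γ → (H →ₗᵢ[ℂ] H)) (h1 : ∀ x, U 1 x = x)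
    (hmul : ∀ g h x, U (g * h) x = U g (U h x)) (g : Γ) (x : H) :
    ofIsometries U h1 hmul g x = U g x := rfl

/-- The restriction of a unitary representation to an invariant subspace. -/
noncomputable def restrict {Γ H : Type*} [Group Γ] [NormedAddCommGroup H]
    [InnerProductSpace ℂ H] (ρ : UnitaryRep Γ H) (K : Submodule ℂ H)
    (hK : ∀ g, ∀ x ∈ K, ρ g x ∈ K) : UnitaryRep Γ K :=
  ofIsometries
    (fun g =>
      { (ρ g).toLinearEquiv.toLinearMap.restrict (hK g) with
        norm_map' := fun x => (ρ g).norm_map (x : H) })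
    (fun x => Subtype.ext (by
      change ρ 1 (x : H) = x
      rw [map_one]; rfl))
    (fun g h x => Subtype.ext (by
      change ρ (g * h) (x : H) = ρ g (ρ h x)
      rw [map_mul]; rfl))

/-- The Hilbert space direct sum of copies of `ρ` indexed by `ι`, acting coordinatewise on
`ℓ²(ι, H)`. -/
noncomputable def directSum {Γ H : Type*} [Group Γ] [NormedAddCommGroup H]
    [InnerProductSpace ℂ H] (ι : Type*) (ρ : UnitaryRep Γ H) :
    UnitaryRep Γ (lp (fun _ : ι => H) 2) :=
  ofIsometries
    (fun g =>
      { toFun := fun f => ⟨fun i => ρ g (f i),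
          memℓp_norm_iff.1 (by
            simpa only [LinearIsometryEquiv.norm_map] using memℓp_norm_iff.2 (lp.memℓp f))⟩
        map_add' := fun f f' => lp.ext (funext fun i => (ρ g).map_add (f i) (f' i))
        map_smul' := fun c f => lp.ext (funext fun i => (ρ g).map_smul c (f i))
        norm_map' := fun f => by
          rw [lp.norm_eq_tsum_rpow (by norm_num), lp.norm_eq_tsum_rpow (by norm_num)]
          congr 1
          exact tsum_congr fun i => congrArg (· ^ _) ((ρ g).norm_map (f i)) })
    (fun f => lp.ext (funext fun i => by
      change ρ 1 (f i) = f i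
      rw [map_one]; rfl))
    (fun g h f => lp.ext (funext fun i => by
      change ρ (g * h) (f i) = ρ g (ρ h (f i))
      rw [map_mul]; rfl))

theorem directSum_apply {Γ H : Type*} [Group Γ] [NormedAddCommGroup H]
    [InnerProductSpace ℂ H] (ι : Type*) (ρ : UnitaryRep Γ H) (g : Γ)
    (f : lp (fun _ : ι => H) 2) (i : ι) : directSum ι ρ g f i = ρ g (f i) := rfl

/-- `ρ₁` is embeddable into `ρ₂`: there is an equivariant linear isometry. -/
def Embeds {Γ H₁ H₂ : Type*} [Group Γ] [NormedAddCommGroup H₁] [InnerProductSpace ℂ H₁]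
    [NormedAddCommGroup H₂] [InnerProductSpace ℂ H₂] (ρ₁ : UnitaryRep Γ H₁)
    (ρ₂ : UnitaryRep Γ H₂) : Prop :=
  ∃ V : H₁ →ₗᵢ[ℂ] H₂, ∀ g x, V (ρ₁ g x) = ρ₂ g (V x)

/-- The left regular representation on `ℓ²(Γ)`: `(λ(g) f)(x) = f (g⁻¹ x)`. -/
noncomputable def leftRegular (Γ : Type*) [Group Γ] :
    UnitaryRep Γ (lp (fun _ : Γ => ℂ) 2) :=
  ofIsometries
    (fun g =>
      { toFun := fun f => ⟨fun x => f (g⁻¹ * x), memℓp_gen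
          ((Equiv.mulLeft g⁻¹).summable_iff.2 ((lp.memℓp f).summable (by norm_num)))⟩
        map_add' := fun _ _ => lp.ext rfl
        map_smul' := fun _ _ => lp.ext rfl
        norm_map' := fun f => by
          rw [lp.norm_eq_tsum_rpow (by norm_num), lp.norm_eq_tsum_rpow (by norm_num)]
          congr 1
          exact (Equiv.mulLeft g⁻¹).tsum_eq (fun x => ‖f x‖ ^ _) })
    (fun f => lp.ext (funext fun x => by
      change f (1⁻¹ * x) = f x
      rw [inv_one, one_mul]))
    (fun g h f => lp.ext (funext fun x => by
      change f ((g * h)⁻¹ * x) = f (h⁻¹ * (g⁻¹ * x))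
      rw [mul_inv_rev, mul_assoc]))

theorem leftRegular_apply {Γ : Type*} [Group Γ] (g : Γ) (f : lp (fun _ : Γ => ℂ) 2) (x : Γ) :
    leftRegular Γ g f x = f (g⁻¹ * x) := rfl

/-- The representation `(ρ(g) ξ)(x) = ξ (g⁻¹ x)` on `L²(X, μ)`. -/
noncomputable def koopmanFull (Γ : Type*) [Group Γ] {X : Type*} [MeasurableSpace X]
    [MulAction Γ X] [MeasurableConstSMul Γ X] (μ : Measure X) [SMulInvariantMeasure Γ X μ] :
    UnitaryRep Γ (Lp ℂ 2 μ) :=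
  ofIsometries
    (fun g => Lp.compMeasurePreservingₗᵢ ℂ (fun x : X => g⁻¹ • x)
      (measurePreserving_smul g⁻¹ μ))
    (fun ξ => by
      refine Lp.ext ((Lp.coeFn_compMeasurePreserving ξ _).trans ?_)
      simp [Function.comp_def])
    (fun g h ξ => by
      refine Lp.ext ((Lp.coeFn_compMeasurePreserving ξ _).trans ?_)
      refine EventuallyEq.trans ?_ (Lp.coeFn_compMeasurePreserving _ _).symm
      refine EventuallyEq.trans ?_ ((measurePreserving_smul g⁻¹ μ).quasiMeasurePreserving.ae_eq
        (Lp.coeFn_compMeasurePreserving ξ (measurePreserving_smul h⁻¹ μ)).symm)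
      simp [Function.comp_def, mul_smul])

theorem koopmanFull_ae_eq {Γ : Type*} [Group Γ] {X : Type*} [MeasurableSpace X]
    [MulAction Γ X] [MeasurableConstSMul Γ X] (μ : Measure X) [SMulInvariantMeasure Γ X μ]
    (g : Γ) (ξ : Lp ℂ 2 μ) : koopmanFull Γ μ g ξ =ᵐ[μ] fun x => ξ (g⁻¹ • x) :=
  Lp.coeFn_compMeasurePreserving ξ (measurePreserving_smul g⁻¹ μ)

/-- `L²(X, μ) ⊖ ℂ1`. -/
noncomputable def L2Zero {X : Type*} [MeasurableSpace X] (μ : Measure X) [IsFiniteMeasure μ] :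
    Submodule ℂ (Lp ℂ 2 μ) :=
  (Submodule.span ℂ {Lp.const 2 μ (1 : ℂ)})ᗮ

theorem koopmanFull_mem_L2Zero {Γ : Type*} [Group Γ] {X : Type*} [MeasurableSpace X]
    [MulAction Γ X] [MeasurableConstSMul Γ X] (μ : Measure X) [IsFiniteMeasure μ]
    [SMulInvariantMeasure Γ X μ] (g : Γ) (ξ : Lp ℂ 2 μ) (hξ : ξ ∈ L2Zero μ) :
    koopmanFull Γ μ g ξ ∈ L2Zero μ := by
  have hc : koopmanFull Γ μ g (Lp.const 2 μ (1 : ℂ)) = Lp.const 2 μ (1 : ℂ) := rfl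
  rw [L2Zero, Submodule.mem_orthogonal_singleton_iff_inner_right] at hξ ⊢
  rw [← hc, LinearIsometryEquiv.inner_map_map, hξ]

/-- The Koopman representation `ρ⁰`: the restriction of `koopmanFull` to `L²(X, μ) ⊖ ℂ1`. -/
noncomputable def koopman (Γ : Type*) [Group Γ] {X : Type*} [MeasurableSpace X]
    [MulAction Γ X] [MeasurableConstSMul Γ X] (μ : Measure X) [IsFiniteMeasure μ]
    [SMulInvariantMeasure Γ X μ] : UnitaryRep Γ (L2Zero μ) :=
  (koopmanFull Γ μ).restrict (L2Zero μ) (koopmanFull_mem_L2Zero μ)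

end UnitaryRep

/-! ## Sofic approximations and sofic measure entropy -/

/-- The normalized counting (uniform probability) measure of a subset of a `d`-element set. -/
noncomputable def unifMeas (d : ℕ) (S : Set (Fin d)) : ℝ := (S.ncard : ℝ) / d

/-- A sofic approximation of `Γ`: maps `σ i : Γ → Sym(d i)`, not assumed to be homomorphisms,
that are asymptotically multiplicative and asymptotically free. -/
structure SoficApproximation (Γ : Type*) [Group Γ] where
  d : ℕ → ℕ
  σ : ∀ i, Γ → Equiv.Perm (Fin (d i))
  tendsto_mul : ∀ g h : Γ,
    Tendsto (fun i => unifMeas (d i) {k | σ i g (σ i h k) = σ i (g * h) k}) atTop (𝓝 1)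
  tendsto_free : ∀ g h : Γ, g ≠ h →
    Tendsto (fun i => unifMeas (d i) {k | σ i g k ≠ σ i h k}) atTop (𝓝 1)

namespace SoficEntropy

/-- For a finite observable `β : X → B` the map `x ↦ (g ↦ β (g⁻¹ x))` from `X` to `B ^ F`. -/
def itinerary {Γ X B : Type*} [Group Γ] [MulAction Γ X] (β : X → B) (F : Finset Γ) (x : X) :
    F → B :=
  fun g => β ((g : Γ)⁻¹ • x)

open Classical in
/-- The microstates `AP(β, F, δ, σ)`: maps `φ : {1, …, d} → B ^ F` whose distribution is
`δ`-close in `ℓ¹` to that of the `F`-itinerary of `β`, and which are `δ`-almost equivariant: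
`φ(j)(g) = φ(σ(g)⁻¹ j)(e)` outside a set of `j`'s of measure less than `δ`, for every `g ∈ F`. -/
def AP {Γ X : Type*} [Group Γ] [MeasurableSpace X] [MulAction Γ X] (μ : Measure X) {m d : ℕ}
    (β : X → Fin m) (F : Finset Γ) (hF : (1 : Γ) ∈ F) (δ : ℝ)
    (σ : Γ → Equiv.Perm (Fin d)) : Set (Fin d → (F → Fin m)) :=
  {φ | (∑ a : F → Fin m, |unifMeas d (φ ⁻¹' {a}) - μ.real (itinerary β F ⁻¹' {a})|) < δ ∧
    ∀ g : F, unifMeas d {j | φ j g ≠ φ ((σ g)⁻¹ j) ⟨1, hF⟩} < δ}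

/-- `h(α; β, F, δ)`, where `pr` is the map with `α = pr ∘ β` almost everywhere: the exponential
growth rate of the number of maps `j ↦ pr (φ(j)(e))` with `φ ∈ AP(β, F, δ, σ_i)`. The logarithm of
`0` is `-∞`. -/
noncomputable def hLoc {Γ X : Type*} [Group Γ] [MeasurableSpace X] [MulAction Γ X]
    (S : SoficApproximation Γ) (μ : Measure X) {k m : ℕ} (β : X → Fin m) (pr : Fin m → Fin k)
    (F : Finset Γ) (hF : (1 : Γ) ∈ F) (δ : ℝ) : EReal :=
  limsup (fun i =>
    ENNReal.log (((fun (φ : Fin (S.d i) → (F → Fin m)) j => pr (φ j ⟨1, hF⟩)) ''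
      AP μ β F hF δ (S.σ i)).ncard : ℝ≥0∞) / ((S.d i : ℝ) : EReal)) atTop

/-- `h(α)` for a finite observable `α`: the infimum of `h(α; β, F, δ)` over all finite observables
`β` refining `α` (through `pr`), all finite `F ⊆ Γ` containing `e`, and all `δ > 0`. -/
noncomputable def hObs {Γ X : Type*} [Group Γ] [MeasurableSpace X] [MulAction Γ X]
    (S : SoficApproximation Γ) (μ : Measure X) {k : ℕ} (α : X → Fin k) : EReal :=
  ⨅ (m : ℕ) (β : X → Fin m) (_ : Measurable β) (pr : Fin m → Fin k)
    (_ : ∀ᵐ x ∂μ, pr (β x) = α x) (F : Finset Γ) (hF : (1 : Γ) ∈ F) (δ : ℝ) (_ : 0 < δ),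
    hLoc S μ β pr F hF δ

/-- The sofic measure entropy `h_{Σ,μ}(X, Γ)`, with values in `{-∞} ∪ [0, ∞]`: the supremum of
`h(α)` over all finite observables `α`. -/
noncomputable def entropy {Γ X : Type*} [Group Γ] [MeasurableSpace X] [MulAction Γ X]
    (S : SoficApproximation Γ) (μ : Measure X) : EReal :=
  ⨆ (k : ℕ) (α : X → Fin k) (_ : Measurable α), hObs S μ α

end SoficEntropy

/-- `Γ ↷ (Y, ν)` is a factor of `Γ ↷ (X, μ)`: there is a measure-preserving map `X → Y` which is
almost everywhere equivariant. -/
def IsFactor (Γ : Type*) {X Y : Type*} [Group Γ] [MeasurableSpace X] [MulAction Γ X]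
    [MeasurableSpace Y] [MulAction Γ Y] (μ : Measure X) (ν : Measure Y) : Prop :=
  ∃ Φ : X → Y, MeasurePreserving Φ μ ν ∧ ∀ g : Γ, ∀ᵐ x ∂μ, Φ (g • x) = g • Φ x

/-- Completely positive entropy with respect to `S`: every factor (on a standard probability space)
that is not a one-atom space has positive entropy. Letting `Y` range over `Type` is no restriction,
whatever the universe of `X`: every standard Borel space is isomorphic to a Borel subset of `ℝ`. -/
def HasCompletelyPositiveEntropy {Γ X : Type*} [Group Γ] [MeasurableSpace X] [MulAction Γ X]
    (S : SoficApproximation Γ) (μ : Measure X) : Prop :=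
  ∀ (Y : Type) [MeasurableSpace Y] [StandardBorelSpace Y] [MulAction Γ Y]
    [MeasurableConstSMul Γ Y] (ν : Measure Y) [IsProbabilityMeasure ν]
    [SMulInvariantMeasure Γ Y ν],
    IsFactor Γ μ ν → (∀ y : Y, ν ≠ Measure.dirac y) → 0 < SoficEntropy.entropy S ν

/-! Call a vector `ξ` singular if elements `f` of the group algebra with arbitrarily small `ℓ²` norm
act on it almost as the identity. The theorem splits into two independent facts about such vectors.

Representation theory (`embeds_of_forall_isSingularVector`): if zero is the only singular vector,
the densely defined map sending `ρ(f)ξ` to `f` may be multivalued, but the closure of its graph in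
`H ⊕ ℓ²(Γ)` meets `H ⊕ 0` trivially. Projecting `(x, 0)` onto this closure and taking the second
coordinate gives a bounded intertwiner to `ℓ²(Γ)` whose kernel is orthogonal to `ξ`. Summing over a
dense sequence of vectors `ξ` gives an injective intertwiner into a countable multiple of the
regular representation, and its polar part is isometric.

Entropy (`SoficEntropy.entropy_le_zero`): if the translates of a singular function `ζ` generate the
σ-algebra, the sofic entropy is at most zero. A good microstate yields a vector `c` in `ℂ^d`, a
discrete model of `ζ`, that is almost fixed by the operator of `f` on `ℂ^d`. By asymptotic freeness
the squared Hilbert–Schmidt norm of this operator is about `d‖f‖²`, which is a small multiple of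
`d`. Hence `c` lies near a subspace of dimension a small multiple of `d`, and a volume bound leaves
few such vectors up to small error. Since `ζ` generates, a labelling is almost a Lipschitz cylinder
function of `c`, so nearby vectors have labellings that are close in the Hamming distance, and small
Hamming balls have small exponential growth.

Under completely positive entropy, the factor generated by a singular function must be a single
atom, so the function is constant; a constant in `L² ⊖ ℂ1` is zero, and the first fact applies to
the Koopman representation. -/

namespace UnitaryRep

/-! ### Intertwiners and direct sums of unitary representations -/

variable {Γ H K : Type*} [Group Γ] [NormedAddCommGroup H] [InnerProductSpace ℂ H]
  [NormedAddCommGroup K] [InnerProductSpace ℂ K]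

theorem apply_inv_apply (ρ : UnitaryRep Γ H) (g : Γ) (x : H) : ρ g (ρ g⁻¹ x) = x := by
  have : (ρ g * ρ g⁻¹) x = x := by rw [← map_mul, mul_inv_cancel, map_one]; rfl
  exact this

theorem mul_apply (ρ : UnitaryRep Γ H) (g h : Γ) (x : H) : ρ (g * h) x = ρ g (ρ h x) := by
  rw [map_mul]; rfl

theorem inner_apply_left (ρ : UnitaryRep Γ H) (g : Γ) (x y : H) :
    inner ℂ (ρ g x) y = inner ℂ x (ρ g⁻¹ y) := by
  rw [← (ρ g).inner_map_map x, apply_inv_apply]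

/-- An injective bounded intertwiner between unitary representations can be replaced by an
isometric one, its polar part. -/
theorem Embeds.of_injective [CompleteSpace H] [CompleteSpace K] {ρ₁ : UnitaryRep Γ H}
    {ρ₂ : UnitaryRep Γ K} (A : H →L[ℂ] K) (hinj : Function.Injective A)
    (hA : ∀ g x, A (ρ₁ g x) = ρ₂ g (A x)) : Embeds ρ₁ ρ₂ := by
  set N : H →L[ℂ] H := A.adjoint ∘L A with hN
  have hN0 : 0 ≤ N := by
    rw [ContinuousLinearMap.nonneg_iff_isPositive]
    exact ContinuousLinearMap.isPositive_adjoint_comp_self A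
  set S : H →L[ℂ] H := CFC.sqrt N with hS
  have hS0 : 0 ≤ S := CFC.sqrt_nonneg N
  have hSS : S * S = N := CFC.sqrt_mul_sqrt_self N hN0
  have hSsa : IsSelfAdjoint S := hS0.isSelfAdjoint
  have hSinner : ∀ x y, inner ℂ (S x) y = inner ℂ x (S y) := fun x y => by
    rw [← ContinuousLinearMap.adjoint_inner_right, hSsa.adjoint_eq]
  have hnorm : ∀ x, ‖S x‖ = ‖A x‖ := by
    intro x
    have h : inner ℂ (S x) (S x) = inner ℂ (A x) (A x) := by
      rw [hSinner, ← mul_apply_eq_comp, hSS, hN, ContinuousLinearMap.comp_apply,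
        ContinuousLinearMap.adjoint_inner_right]
    rw [inner_self_eq_norm_sq_to_K, inner_self_eq_norm_sq_to_K] at h
    have h' : ‖S x‖ ^ 2 = ‖A x‖ ^ 2 := by exact_mod_cast h
    exact (sq_eq_sq₀ (norm_nonneg _) (norm_nonneg _)).1 h'
  have hadj : ∀ g y, A.adjoint (ρ₂ g y) = ρ₁ g (A.adjoint y) := by
    intro g y
    refine ext_inner_left ℂ fun v => ?_
    rw [ContinuousLinearMap.adjoint_inner_right, ← inner_conj_symm, inner_apply_left, ← hA,
      inner_conj_symm, ← ContinuousLinearMap.adjoint_inner_right, ← inner_conj_symm,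
      ← inner_conj_symm v]
    congr 1
    rw [inner_apply_left]
  have hcomm : ∀ g x, S (ρ₁ g x) = ρ₁ g (S x) := by
    intro g
    let u : H →L[ℂ] H := ((ρ₁ g).toContinuousLinearEquiv : H →L[ℂ] H)
    have h1 : Commute N u := by
      ext x
      change A.adjoint (A (ρ₁ g x)) = ρ₁ g (A.adjoint (A x))
      rw [hA, hadj]
    -- The square root is a functional calculus of `N`, so it commutes with whatever commutes with
    -- `N`.
    have h2 : Commute S u := h1.cfcₙ_nnreal _
    intro x
    exact congrArg (fun T : H →L[ℂ] H => T x) h2.eq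
  -- The range of the self-adjoint `S` has orthocomplement `ker S`, which is trivial because `‖S x‖
  -- = ‖A x‖` and `A` is injective.
  have hdense : DenseRange S.toLinearMap := by
    have hker : S.ker = ⊥ := by
      rw [LinearMap.ker_eq_bot']
      intro x hx
      have hx' : S x = 0 := hx
      have : A x = 0 := by rw [← norm_eq_zero, ← hnorm, hx', norm_zero]
      exact hinj (by rw [this, map_zero])
    have h1 : S.rangeᗮ = ⊥ := by
      rw [ContinuousLinearMap.orthogonal_range, hSsa.adjoint_eq, hker]
    have h2 := (Submodule.topologicalClosure_eq_top_iff (K := S.range)).2 h1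
    have h3 := (Submodule.dense_iff_topologicalClosure_eq_top (s := S.range)).2 h2
    exact h3
  have hbound : ∀ x, ‖A.toLinearMap x‖ ≤ 1 * ‖S.toLinearMap x‖ := fun x => by
    rw [one_mul]; exact (hnorm x).ge
  -- The polar part: `S x ↦ A x` is well defined and isometric on the range of `S`, hence extends to
  -- `H`.
  let V : H →L[ℂ] K := A.toLinearMap.extendOfNorm S.toLinearMap
  have hV : ∀ x, V (S x) = A x := fun x => LinearMap.extendOfNorm_eq hdense ⟨1, hbound⟩ x
  refine ⟨{ V.toLinearMap with norm_map' := ?_ }, ?_⟩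
  · intro x
    change ‖V x‖ = ‖x‖
    refine hdense.induction_on (p := fun x => ‖V x‖ = ‖x‖) x
      (isClosed_eq (by fun_prop) (by fun_prop)) fun y => ?_
    change ‖V (S y)‖ = ‖S y‖
    rw [hV, hnorm]
  · intro g x
    change V (ρ₁ g x) = ρ₂ g (V x)
    refine hdense.induction_on (p := fun x => V (ρ₁ g x) = ρ₂ g (V x)) x
      (isClosed_eq (V.continuous.comp (ρ₁ g).continuous)
        ((ρ₂ g).continuous.comp V.continuous)) fun y => ?_
    change V (ρ₁ g (S y)) = ρ₂ g (V (S y))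
    rw [← hcomm, hV, hV, hA]

/-- The orthogonal direct sum of two linear isometries. -/
noncomputable def prodIsometry (U : H →ₗᵢ[ℂ] H) (V : K →ₗᵢ[ℂ] K) :
    WithLp 2 (H × K) →ₗᵢ[ℂ] WithLp 2 (H × K) where
  toFun x := WithLp.toLp 2 (U x.fst, V x.snd)
  map_add' x y := congrArg (WithLp.toLp 2) (Prod.ext (U.map_add _ _) (V.map_add _ _))
  map_smul' c x := congrArg (WithLp.toLp 2) (Prod.ext (U.map_smul _ _) (V.map_smul _ _))
  norm_map' x := by
    refine (sq_eq_sq₀ (norm_nonneg _) (norm_nonneg _)).1 ?_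
    rw [WithLp.prod_norm_sq_eq_of_L2 x, ← U.norm_map x.fst, ← V.norm_map x.snd]
    exact WithLp.prod_norm_sq_eq_of_L2 (WithLp.toLp 2 (U x.fst, V x.snd))

/-- The direct sum of two unitary representations. -/
noncomputable def prod (ρ₁ : UnitaryRep Γ H) (ρ₂ : UnitaryRep Γ K) :
    UnitaryRep Γ (WithLp 2 (H × K)) :=
  ofIsometries (fun g => prodIsometry (ρ₁ g).toLinearIsometry (ρ₂ g).toLinearIsometry)
    (fun x => congrArg (WithLp.toLp 2) (Prod.ext
      (congrArg (fun u : H ≃ₗᵢ[ℂ] H => u x.fst) ρ₁.map_one)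
      (congrArg (fun u : K ≃ₗᵢ[ℂ] K => u x.snd) ρ₂.map_one)))
    (fun g h x => congrArg (WithLp.toLp 2) (Prod.ext
      (mul_apply ρ₁ g h x.fst) (mul_apply ρ₂ g h x.snd)))

theorem prod_apply (ρ₁ : UnitaryRep Γ H) (ρ₂ : UnitaryRep Γ K) (g : Γ) (x : WithLp 2 (H × K)) :
    prod ρ₁ ρ₂ g x = WithLp.toLp 2 (ρ₁ g x.fst, ρ₂ g x.snd) := rfl

/-- The orthogonal projection onto an invariant subspace is an intertwiner. -/
theorem starProjection_apply_comm (ρ : UnitaryRep Γ H) (M : Submodule ℂ H)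
    [M.HasOrthogonalProjection] (hM : ∀ g, ∀ x ∈ M, ρ g x ∈ M) (g : Γ) (x : H) :
    M.starProjection (ρ g x) = ρ g (M.starProjection x) := by
  refine (Submodule.eq_starProjection_of_mem_of_inner_eq_zero (u := ρ g x)
    (hM g _ (Submodule.starProjection_apply_mem M x)) fun w hw => ?_)
  rw [← map_sub, inner_apply_left]
  exact Submodule.starProjection_inner_eq_zero x _ (hM _ _ hw)

/-! ### Singular vectors and closures of orbit graphs -/

/-- The action `f ↦ ∑ f(g) ρ(g) ξ` of the group algebra on a vector `ξ`. -/
noncomputable def orbitMap (ρ : UnitaryRep Γ H) (ξ : H) : (Γ →₀ ℂ) →ₗ[ℂ] H :=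
  Finsupp.linearCombination ℂ fun g => ρ g ξ

theorem orbitMap_apply (ρ : UnitaryRep Γ H) (ξ : H) (f : Γ →₀ ℂ) :
    ρ.orbitMap ξ f = ∑ g ∈ f.support, f g • ρ g ξ := by
  rw [orbitMap, Finsupp.linearCombination_apply, Finsupp.sum]

/-- A vector `ξ` on which finitely supported functions on `Γ` of arbitrarily small `ℓ²` norm act
almost as the identity. -/
def IsSingularVector (ρ : UnitaryRep Γ H) (ξ : H) : Prop :=
  ∀ ε > 0, ∃ f : Γ →₀ ℂ, ‖ρ.orbitMap ξ f - ξ‖ < ε ∧ ∑ g ∈ f.support, ‖f g‖ ^ 2 < ε ^ 2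

open Classical in
/-- The inclusion of the finitely supported functions in `ℓ²(Γ)`. -/
noncomputable def finsuppToL2 (Γ : Type*) : (Γ →₀ ℂ) →ₗ[ℂ] lp (fun _ : Γ => ℂ) 2 :=
  Finsupp.linearCombination ℂ fun g => lp.single 2 g (1 : ℂ)

theorem norm_finsuppToL2_sq {Γ : Type*} (f : Γ →₀ ℂ) :
    ‖finsuppToL2 Γ f‖ ^ 2 = ∑ g ∈ f.support, ‖f g‖ ^ 2 := by
  classical
  have h := lp.norm_sum_single (p := 2) (E := fun _ : Γ => ℂ) (by norm_num) (fun g => f g) f.support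
  have h2 : finsuppToL2 Γ f = ∑ i ∈ f.support, lp.single 2 i (f i) := by
    rw [finsuppToL2, Finsupp.linearCombination_apply, Finsupp.sum]
    refine Finset.sum_congr rfl fun i _ => ?_
    rw [← lp.single_smul, smul_eq_mul, mul_one]
  rw [h2]
  simpa using h

/-- The closure in `H ⊕ ℓ²(Γ)` of the graph of the densely defined map `f ↦ ρ(f) ξ`. -/
noncomputable def orbitGraph (ρ : UnitaryRep Γ H) (ξ : H) :
    Submodule ℂ (WithLp 2 (H × lp (fun _ : Γ => ℂ) 2)) :=
  (LinearMap.range ((WithLp.linearEquiv 2 ℂ (H × lp (fun _ : Γ => ℂ) 2)).symm.toLinearMap ∘ₗ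
    (ρ.orbitMap ξ).prod (finsuppToL2 Γ))).topologicalClosure

/-- The squared distance from `(η, 0)` to the graph point of `f` is `‖ρ(f)ξ - η‖² + ‖f‖²`. For `η =
ξ` the criterion is the definition of a singular vector. -/
theorem mem_orbitGraph_iff (ρ : UnitaryRep Γ H) (ξ η : H) :
    WithLp.toLp 2 (η, 0) ∈ ρ.orbitGraph ξ ↔
      ∀ ε > 0, ∃ f : Γ →₀ ℂ, ‖ρ.orbitMap ξ f - η‖ < ε ∧ ∑ g ∈ f.support, ‖f g‖ ^ 2 < ε ^ 2 := by
  rw [orbitGraph, ← SetLike.mem_coe, Submodule.topologicalClosure_coe, Metric.mem_closure_iff]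
  have key : ∀ f : Γ →₀ ℂ, dist (WithLp.toLp 2 (η, (0 : lp (fun _ : Γ => ℂ) 2)))
      (WithLp.toLp 2 (ρ.orbitMap ξ f, finsuppToL2 Γ f)) ^ 2 =
      ‖ρ.orbitMap ξ f - η‖ ^ 2 + ∑ g ∈ f.support, ‖f g‖ ^ 2 := by
    intro f
    rw [dist_comm, dist_eq_norm, WithLp.prod_norm_sq_eq_of_L2, ← norm_finsuppToL2_sq]
    simp
  constructor
  · intro h ε hε
    obtain ⟨_, ⟨f, rfl⟩, hf⟩ := h ε hε
    have h2 := pow_lt_pow_left₀ hf dist_nonneg two_ne_zero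
    have h3 := key f
    have h4 : 0 ≤ ∑ g ∈ f.support, ‖f g‖ ^ 2 := Finset.sum_nonneg fun _ _ => by positivity
    refine ⟨f, lt_of_pow_lt_pow_left₀ 2 hε.le ?_, ?_⟩
    · linarith [h3.symm.trans_lt h2]
    · linarith [h3.symm.trans_lt h2, sq_nonneg ‖ρ.orbitMap ξ f - η‖]
  · intro h ε hε
    obtain ⟨f, h1, h2⟩ := h (ε / 2) (by positivity)
    refine ⟨_, ⟨f, rfl⟩, lt_of_pow_lt_pow_left₀ 2 hε.le ?_⟩
    refine (key f).trans_lt ?_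
    have := pow_lt_pow_left₀ h1 (norm_nonneg _) two_ne_zero
    nlinarith

theorem isSingularVector_iff (ρ : UnitaryRep Γ H) (ξ : H) :
    ρ.IsSingularVector ξ ↔ WithLp.toLp 2 (ξ, 0) ∈ ρ.orbitGraph ξ :=
  (mem_orbitGraph_iff ρ ξ ξ).symm

theorem orbitMap_mapDomain (ρ : UnitaryRep Γ H) (ξ : H) (g : Γ) (f : Γ →₀ ℂ) :
    ρ.orbitMap ξ (f.mapDomain (g * ·)) = ρ g (ρ.orbitMap ξ f) := by
  rw [orbitMap, Finsupp.linearCombination_mapDomain, Finsupp.linearCombination_apply,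
    Finsupp.linearCombination_apply, Finsupp.sum, Finsupp.sum, map_sum]
  refine Finset.sum_congr rfl fun h _ => ?_
  rw [map_smul, Function.comp_apply, mul_apply]

theorem finsuppToL2_mapDomain (g : Γ) (f : Γ →₀ ℂ) :
    finsuppToL2 Γ (f.mapDomain (g * ·)) = leftRegular Γ g (finsuppToL2 Γ f) := by
  classical
  rw [finsuppToL2, Finsupp.linearCombination_mapDomain, Finsupp.linearCombination_apply,
    Finsupp.linearCombination_apply, Finsupp.sum, Finsupp.sum, map_sum]
  refine Finset.sum_congr rfl fun h _ => ?_
  rw [map_smul, Function.comp_apply]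
  congr 1
  ext x
  rw [leftRegular_apply, lp.coeFn_single, lp.coeFn_single]
  simp only [Pi.single_apply, eq_comm (a := x), eq_inv_mul_iff_mul_eq,
    eq_comm (a := g⁻¹ * x)]

/-- Left translation of `f` by `g` acts as `ρ g` on one coordinate and as the regular representation
on the other, so the graph is invariant; continuity passes this to the closure. -/
theorem orbitGraph_invariant (ρ : UnitaryRep Γ H) (ξ : H) (g : Γ)
    (x : WithLp 2 (H × lp (fun _ : Γ => ℂ) 2)) (hx : x ∈ ρ.orbitGraph ξ) :
    prod ρ (leftRegular Γ) g x ∈ ρ.orbitGraph ξ := by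
  refine map_mem_closure (prod ρ (leftRegular Γ) g).continuous hx ?_
  rintro _ ⟨f, rfl⟩
  refine ⟨f.mapDomain (g * ·), ?_⟩
  change WithLp.toLp 2 (ρ.orbitMap ξ _, finsuppToL2 Γ _) =
    WithLp.toLp 2 (ρ g (ρ.orbitMap ξ f), leftRegular Γ g (finsuppToL2 Γ f))
  rw [orbitMap_mapDomain, finsuppToL2_mapDomain]

theorem mem_orbitGraph_self (ρ : UnitaryRep Γ H) (ξ : H) :
    WithLp.toLp 2 (ξ, finsuppToL2 Γ (Finsupp.single 1 1)) ∈ ρ.orbitGraph ξ := by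
  refine Submodule.le_topologicalClosure _ ⟨Finsupp.single 1 1, ?_⟩
  change WithLp.toLp 2 (ρ.orbitMap ξ _, finsuppToL2 Γ _) = _
  rw [orbitMap, Finsupp.linearCombination_single, one_smul, map_one]
  rfl

/-- Without nonzero singular vectors, the closure of the graph of `f ↦ ρ(f) ξ` is a graph. -/
theorem eq_zero_of_mem_orbitGraph [CompleteSpace H] {ρ : UnitaryRep Γ H}
    (hρ : ∀ ξ, ρ.IsSingularVector ξ → ξ = 0) {ξ η : H}
    (hη : WithLp.toLp 2 (η, 0) ∈ ρ.orbitGraph ξ) : η = 0 := by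
  let ι : H →ₗ[ℂ] WithLp 2 (H × lp (fun _ : Γ => ℂ) 2) :=
    (WithLp.linearEquiv 2 ℂ (H × lp (fun _ : Γ => ℂ) 2)).symm.toLinearMap ∘ₗ
      LinearMap.inl ℂ H _
  have hι : Continuous ι :=
    (WithLp.prod_continuous_toLp 2 H _).comp (continuous_id.prodMk continuous_const)
  -- `M` is the multivalued part of the closed relation; it is closed and invariant, so its
  -- projection commutes with `ρ`. The aim is that the projection of `ξ` to `M` is singular.
  let M : Submodule ℂ H := (ρ.orbitGraph ξ).comap ι
  have hMc : IsClosed (M : Set H) := (Submodule.isClosed_topologicalClosure _).preimage hι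
  have : CompleteSpace M := hMc.completeSpace_coe
  have hM : ∀ g, ∀ x ∈ M, ρ g x ∈ M := by
    intro g x hx
    have h := orbitGraph_invariant ρ ξ g _ hx
    change WithLp.toLp 2 (ρ g x, leftRegular Γ g 0) ∈ _ at h
    rw [map_zero] at h
    exact h
  have hproj : ∀ f, M.starProjection (ρ.orbitMap ξ f) = ρ.orbitMap (M.starProjection ξ) f := by
    intro f
    simp only [orbitMap_apply, map_sum, map_smul, starProjection_apply_comm ρ M hM]
  -- Projecting an approximation `ρ(f)ξ ≈ y` to `M` does not increase the error and turns `ξ` into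
  -- its projection, with the same `f`.
  have hmem : ∀ y ∈ M, WithLp.toLp 2 (y, 0) ∈ ρ.orbitGraph (M.starProjection ξ) := by
    intro y hy
    rw [mem_orbitGraph_iff]
    intro ε hε
    obtain ⟨f, hf, hf2⟩ := (mem_orbitGraph_iff ρ ξ y).1 hy ε hε
    refine ⟨f, lt_of_le_of_lt ?_ hf, hf2⟩
    rw [← hproj]
    nth_rewrite 1 [← Submodule.starProjection_eq_self_iff.2 hy]
    rw [← map_sub]
    exact Submodule.norm_starProjection_apply_le M _
  -- Taking `y` to be the projection of `ξ` itself shows that it is a singular vector.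
  have h0 : M.starProjection ξ = 0 :=
    hρ _ ((isSingularVector_iff _ _).2 (hmem _ (Submodule.starProjection_apply_mem M ξ)))
  have h1 := (mem_orbitGraph_iff ρ _ η).1 (hmem η hη)
  rw [h0] at h1
  by_contra hne
  obtain ⟨f, hf, -⟩ := h1 ‖η‖ (norm_pos_iff.2 hne)
  simp [orbitMap_apply] at hf

/-! ### From orbit graphs to an embedding into the regular representation -/

/-- The compression to `ℓ²(Γ)` of the projection onto `orbitGraph ρ ξ`. -/
noncomputable def graphIntertwiner [CompleteSpace H] (ρ : UnitaryRep Γ H) (ξ : H) :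
    H →L[ℂ] lp (fun _ : Γ => ℂ) 2 :=
  haveI : CompleteSpace (ρ.orbitGraph ξ) :=
    (Submodule.isClosed_topologicalClosure _).completeSpace_coe
  WithLp.sndL 2 ℂ H (lp (fun _ : Γ => ℂ) 2) ∘L (ρ.orbitGraph ξ).starProjection ∘L
    ((WithLp.prodContinuousLinearEquiv 2 ℂ H (lp (fun _ : Γ => ℂ) 2)).symm :
      (H × lp (fun _ : Γ => ℂ) 2) →L[ℂ] WithLp 2 (H × lp (fun _ : Γ => ℂ) 2)) ∘L
    ContinuousLinearMap.inl ℂ H (lp (fun _ : Γ => ℂ) 2)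

theorem graphIntertwiner_comm [CompleteSpace H] (ρ : UnitaryRep Γ H) (ξ : H) (g : Γ) (x : H) :
    ρ.graphIntertwiner ξ (ρ g x) = leftRegular Γ g (ρ.graphIntertwiner ξ x) := by
  have : CompleteSpace (ρ.orbitGraph ξ) :=
    (Submodule.isClosed_topologicalClosure _).completeSpace_coe
  have h := starProjection_apply_comm (prod ρ (leftRegular Γ)) (ρ.orbitGraph ξ)
    (orbitGraph_invariant ρ ξ) g (WithLp.toLp 2 (x, 0))
  have h2 : prod ρ (leftRegular Γ) g (WithLp.toLp 2 (x, 0)) = WithLp.toLp 2 (ρ g x, 0) := by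
    rw [prod_apply]; simp
  rw [h2] at h
  change ((ρ.orbitGraph ξ).starProjection (WithLp.toLp 2 (ρ g x, 0))).snd = _
  rw [h]
  rfl

theorem norm_graphIntertwiner_le [CompleteSpace H] (ρ : UnitaryRep Γ H) (ξ x : H) :
    ‖ρ.graphIntertwiner ξ x‖ ≤ ‖x‖ := by
  have : CompleteSpace (ρ.orbitGraph ξ) :=
    (Submodule.isClosed_topologicalClosure _).completeSpace_coe
  refine (WithLp.norm_snd_le _ ((ρ.orbitGraph ξ).starProjection (WithLp.toLp 2 (x, 0)))).trans ?_
  refine (Submodule.norm_starProjection_apply_le _ _).trans ?_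
  rw [WithLp.norm_toLp_fst]

/-- If the second coordinate of the projection of `(x, 0)` vanishes, the projection lies in the part
of the closed graph over zero, so it is zero. Then `(x, 0)` is orthogonal to the graph, in
particular to its point `(ξ, δ₁)`. -/
theorem inner_eq_zero_of_graphIntertwiner_eq_zero [CompleteSpace H] {ρ : UnitaryRep Γ H}
    (hρ : ∀ ξ, ρ.IsSingularVector ξ → ξ = 0) {ξ x : H} (hx : ρ.graphIntertwiner ξ x = 0) :
    inner ℂ x ξ = 0 := by
  have : CompleteSpace (ρ.orbitGraph ξ) :=
    (Submodule.isClosed_topologicalClosure _).completeSpace_coe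
  set w := (ρ.orbitGraph ξ).starProjection (WithLp.toLp 2 (x, 0)) with hw
  have hw2 : w = WithLp.toLp 2 (w.fst, 0) := by
    have : w.snd = 0 := hx
    rw [← this]; rfl
  have hwm : w ∈ ρ.orbitGraph ξ := Submodule.starProjection_apply_mem _ _
  have hw0 : w = 0 := by
    rw [hw2] at hwm
    rw [hw2, eq_zero_of_mem_orbitGraph hρ hwm]; rfl
  have h := Submodule.starProjection_inner_eq_zero (K := ρ.orbitGraph ξ) (WithLp.toLp 2 (x, 0)) _
    (mem_orbitGraph_self ρ ξ)
  rw [← hw, hw0, sub_zero, WithLp.prod_inner_apply] at h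
  simpa using h

/-- A unitary representation on a separable Hilbert space without nonzero singular vectors embeds
into a countable multiple of the left regular representation. -/
theorem embeds_of_forall_isSingularVector [CompleteSpace H] [TopologicalSpace.SeparableSpace H]
    {ρ : UnitaryRep Γ H} (hρ : ∀ ξ, ρ.IsSingularVector ξ → ξ = 0) :
    Embeds ρ (directSum ℕ (leftRegular Γ)) := by
  let x : ℕ → H := TopologicalSpace.denseSeq H
  -- The weights `2⁻ⁿ` make the contractions square summable.
  let a : ℕ → H → lp (fun _ : Γ => ℂ) 2 := fun n v =>
    ((1 / 2 : ℂ) ^ n) • ρ.graphIntertwiner (x n) v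
  have hbound : ∀ n v, ‖a n v‖ ^ (2 : ℝ) ≤ (1 / 4 : ℝ) ^ n * ‖v‖ ^ 2 := by
    intro n v
    have h1 := norm_graphIntertwiner_le ρ (x n) v
    have h2 : ‖a n v‖ = (1 / 2 : ℝ) ^ n * ‖ρ.graphIntertwiner (x n) v‖ := by
      simp only [a, norm_smul, norm_pow]; norm_num
    rw [Real.rpow_two, h2, mul_pow, ← pow_mul, mul_comm n 2, pow_mul]
    norm_num only
    gcongr
  have hsum : ∀ v : H, Summable fun n : ℕ => (1 / 4 : ℝ) ^ n * ‖v‖ ^ 2 := fun v =>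
    (summable_geometric_of_lt_one (by norm_num) (by norm_num)).mul_right _
  have hmem : ∀ v, Memℓp (fun n => a n v) 2 := fun v => by
    refine memℓp_gen ?_
    simp only [ENNReal.toReal_ofNat]
    exact Summable.of_nonneg_of_le (fun n => by positivity) (fun n => hbound n v) (hsum v)
  let A₀ : H →ₗ[ℂ] lp (fun _ : ℕ => lp (fun _ : Γ => ℂ) 2) 2 :=
    { toFun := fun v => ⟨fun n => a n v, hmem v⟩
      map_add' := fun v w => lp.ext (funext fun n => by
        change a n (v + w) = a n v + a n w
        simp only [a, map_add, smul_add])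
      map_smul' := fun c v => lp.ext (funext fun n => by
        change a n (c • v) = c • a n v
        simp only [a, map_smul, smul_comm c]) }
  have hA₀ : ∀ v, ‖A₀ v‖ ≤ 2 * ‖v‖ := by
    intro v
    refine lp.norm_le_of_tsum_le (by norm_num) (by positivity) ?_
    simp only [ENNReal.toReal_ofNat]
    calc ∑' n, ‖(A₀ v) n‖ ^ (2 : ℝ) ≤ ∑' n : ℕ, (1 / 4 : ℝ) ^ n * ‖v‖ ^ 2 :=
          Summable.tsum_le_tsum (fun n => hbound n v)
            (Summable.of_nonneg_of_le (fun n => by positivity) (fun n => hbound n v) (hsum v))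
            (hsum v)
      _ = 4 / 3 * ‖v‖ ^ 2 := by
          rw [tsum_mul_right, tsum_geometric_of_lt_one (by norm_num) (by norm_num)]; norm_num
      _ ≤ (2 * ‖v‖) ^ (2 : ℝ) := by
          rw [Real.rpow_two]; nlinarith [sq_nonneg ‖v‖]
  let A := A₀.mkContinuous 2 hA₀
  refine Embeds.of_injective A ?_ ?_
  · rw [injective_iff_map_eq_zero]
    intro v hv
    -- A vector in the kernel of every component is orthogonal to the whole dense sequence.
    have h0 : ∀ n, inner ℂ v (x n) = 0 := by
      intro n
      have h1 : a n v = 0 :=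
        congrArg (fun f : lp (fun _ : ℕ => lp (fun _ : Γ => ℂ) 2) 2 => f n) hv
      refine inner_eq_zero_of_graphIntertwiner_eq_zero hρ ?_
      rcases smul_eq_zero.1 h1 with h2 | h2
      · exact absurd h2 (pow_ne_zero _ (by norm_num))
      · exact h2
    have h3 : ∀ w, inner ℂ v w = 0 := fun w =>
      (TopologicalSpace.denseRange_denseSeq H).induction_on (p := fun w => inner ℂ v w = 0) w
        (isClosed_eq (by fun_prop) continuous_const) h0
    exact inner_self_eq_zero.1 (h3 v)
  · intro g v
    refine lp.ext (funext fun n => ?_)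
    rw [directSum_apply]
    change a n (ρ g v) = leftRegular Γ g (a n v)
    simp only [a, map_smul, graphIntertwiner_comm]

end UnitaryRep

/-! ## Packing bounds -/

/-- An `r`-separated subset of the ball of radius `R` in a real normed space of dimension `n` has
at most `(1 + 2R/r)^n` elements. -/
theorem card_le_pow_of_separated {E : Type*} [NormedAddCommGroup E] [NormedSpace ℝ E]
    [FiniteDimensional ℝ E] (s : Finset E) {R r : ℝ} (hR : 0 ≤ R) (hr : 0 < r)
    (hs : ∀ c ∈ s, ‖c‖ ≤ R) (h : ∀ c ∈ s, ∀ d ∈ s, c ≠ d → r ≤ ‖c - d‖) :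
    (s.card : ℝ) ≤ (1 + 2 * R / r) ^ Module.finrank ℝ E := by
  borelize E
  let μ : Measure E := Measure.addHaar
  have hδ : 0 < r / 2 := by positivity
  have hρ : 0 < R + r / 2 := by positivity
  -- The balls of radius `r / 2` are disjoint and lie in the ball of radius `R + r / 2`; the bound
  -- is the comparison of volumes.
  have D : Set.Pairwise (s : Set E)
      (Function.onFun Disjoint fun c => Metric.ball (c : E) (r / 2)) := by
    rintro c hc d hd hcd
    apply Metric.ball_disjoint_ball
    rw [dist_eq_norm, add_halves]
    exact h c hc d hd hcd
  have A_subset : (⋃ c ∈ s, Metric.ball (c : E) (r / 2)) ⊆ Metric.ball (0 : E) (R + r / 2) := by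
    refine Set.iUnion₂_subset fun x hx => ?_
    apply Metric.ball_subset_ball'
    rw [dist_zero_right]
    linarith [hs x hx]
  have I : (s.card : ℝ≥0∞) * ENNReal.ofReal ((r / 2) ^ Module.finrank ℝ E) *
      μ (Metric.ball 0 1) ≤
      ENNReal.ofReal ((R + r / 2) ^ Module.finrank ℝ E) * μ (Metric.ball 0 1) :=
    calc
      _ = μ (⋃ c ∈ s, Metric.ball (c : E) (r / 2)) := by
        rw [measure_biUnion_finset D fun c _ => measurableSet_ball]
        simp only [μ.addHaar_ball_of_pos _ hδ]
        simp only [Finset.sum_const, nsmul_eq_mul, mul_assoc]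
      _ ≤ μ (Metric.ball (0 : E) (R + r / 2)) := measure_mono A_subset
      _ = _ := by simp only [μ.addHaar_ball_of_pos _ hρ]
  have J := (ENNReal.mul_le_mul_iff_left (Metric.measure_ball_pos _ _ zero_lt_one).ne'
    measure_ball_lt_top.ne).1 I
  have K := ENNReal.toReal_le_of_le_ofReal (pow_nonneg hρ.le _) J
  rw [ENNReal.toReal_mul, ENNReal.toReal_natCast, ENNReal.toReal_ofReal (by positivity)] at K
  have h2 : 1 + 2 * R / r = (R + r / 2) / (r / 2) := by field_simp; ring
  rw [h2, div_pow, le_div_iff₀ (by positivity)]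
  exact K

/-- Singular value truncation: up to an error of operator norm at most `κ`, a linear map `T` takes
values in a subspace of dimension at most `‖T‖²_HS / κ²`. -/
theorem exists_submodule_approx {E ι : Type*} [NormedAddCommGroup E] [InnerProductSpace ℂ E]
    [FiniteDimensional ℂ E] [Fintype ι] (b : OrthonormalBasis ι ℂ E) (T : E →ₗ[ℂ] E) {κ : ℝ}
    (hκ : 0 < κ) : ∃ W : Submodule ℂ E,
      (Module.finrank ℂ W : ℝ) * κ ^ 2 ≤ ∑ j, ‖T (b j)‖ ^ 2 ∧
      ∀ v, ∃ w ∈ W, ‖T v - w‖ ≤ κ * ‖v‖ := by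
  classical
  have hsymm := LinearMap.isSymmetric_adjoint_mul_self T
  let n := Module.finrank ℂ E
  let e : OrthonormalBasis (Fin n) ℂ E := hsymm.eigenvectorBasis rfl
  -- In an eigenbasis of `T* T` the images `T (e i)` are pairwise orthogonal, with norms the
  -- singular values of `T`.
  have hip : ∀ i j, inner ℂ (T (e i)) (T (e j)) = if i = j then ((‖T (e i)‖ : ℂ)) ^ 2 else 0 := by
    intro i j
    split_ifs with hij
    · subst hij
      exact inner_self_eq_norm_sq_to_K _
    · have h1 : inner ℂ (T (e i)) (T (e j)) = inner ℂ (e i) ((T.adjoint * T) (e j)) := by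
        rw [Module.End.mul_apply, LinearMap.adjoint_inner_right]
      rw [h1, hsymm.apply_eigenvectorBasis rfl j, inner_smul_right,
        orthonormal_iff_ite.1 (hsymm.eigenvectorBasis rfl).orthonormal, if_neg hij, mul_zero]
  -- Both sides are the trace of `T* T`.
  have htr : ∑ i, ‖T (e i)‖ ^ 2 = ∑ j, ‖T (b j)‖ ^ 2 := by
    have h1 := LinearMap.trace_eq_sum_inner (T.adjoint * T) e
    have h2 := LinearMap.trace_eq_sum_inner (T.adjoint * T) b
    rw [h1] at h2
    simp only [Module.End.mul_apply, LinearMap.adjoint_inner_right,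
      inner_self_eq_norm_sq_to_K] at h2
    exact_mod_cast h2
  -- Keep the singular values at least `κ`; each contributes at least `κ²` to the Hilbert–Schmidt
  -- norm, which bounds their number.
  let I : Finset (Fin n) := Finset.univ.filter fun i => κ ^ 2 ≤ ‖T (e i)‖ ^ 2
  refine ⟨Submodule.span ℂ (↑(I.image fun i => T (e i)) : Set E), ?_, ?_⟩
  · have h1 : Module.finrank ℂ (Submodule.span ℂ (↑(I.image fun i => T (e i)) : Set E)) ≤ I.card :=
      (finrank_span_finset_le_card _).trans Finset.card_image_le
    calc _ ≤ (I.card : ℝ) * κ ^ 2 := by gcongr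
      _ = ∑ i ∈ I, κ ^ 2 := by rw [Finset.sum_const, nsmul_eq_mul]
      _ ≤ ∑ i ∈ I, ‖T (e i)‖ ^ 2 := Finset.sum_le_sum fun i hi => (Finset.mem_filter.1 hi).2
      _ ≤ ∑ i, ‖T (e i)‖ ^ 2 :=
        Finset.sum_le_sum_of_subset_of_nonneg (Finset.subset_univ _) fun _ _ _ => by positivity
      _ = _ := htr
  · intro v
    refine ⟨∑ i ∈ I, e.repr v i • T (e i), Submodule.sum_mem _ fun i hi =>
      Submodule.smul_mem _ _ (Submodule.subset_span (Finset.mem_coe.2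
        (Finset.mem_image_of_mem _ hi))), ?_⟩
    have h1 : T v = ∑ i, e.repr v i • T (e i) := by
      conv_lhs => rw [← e.sum_repr v]
      simp only [map_sum, map_smul]
    have h2 : T v - ∑ i ∈ I, e.repr v i • T (e i) = ∑ i ∈ Iᶜ, e.repr v i • T (e i) := by
      rw [h1, ← Finset.sum_add_sum_compl I, add_sub_cancel_left]
    have h3 : ‖∑ i ∈ Iᶜ, e.repr v i • T (e i)‖ ^ 2 =
        ∑ i ∈ Iᶜ, ‖e.repr v i‖ ^ 2 * ‖T (e i)‖ ^ 2 := by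
      have : ((‖∑ i ∈ Iᶜ, e.repr v i • T (e i)‖ : ℂ)) ^ 2 =
          ((∑ i ∈ Iᶜ, ‖e.repr v i‖ ^ 2 * ‖T (e i)‖ ^ 2 : ℝ) : ℂ) := by
        refine (inner_self_eq_norm_sq_to_K (𝕜 := ℂ)
          (∑ i ∈ Iᶜ, e.repr v i • T (e i))).symm.trans ?_
        rw [sum_inner]
        push_cast
        refine Finset.sum_congr rfl fun i hi => ?_
        rw [inner_sum, Finset.sum_eq_single i]
        · rw [inner_smul_left, inner_smul_right, hip, if_pos rfl, ← mul_assoc,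
            ← Complex.conj_mul']
        · intro j _ hj
          rw [inner_smul_left, inner_smul_right, hip, if_neg hj.symm, mul_zero, mul_zero]
        · exact fun h => absurd hi h
      exact_mod_cast this
    refine (sq_le_sq₀ (norm_nonneg _) (by positivity)).1 ?_
    rw [h2, h3, mul_pow]
    calc _ ≤ ∑ i ∈ Iᶜ, ‖e.repr v i‖ ^ 2 * κ ^ 2 := by
          refine Finset.sum_le_sum fun i hi => ?_
          have : ‖T (e i)‖ ^ 2 ≤ κ ^ 2 := by
            simp only [I, Finset.mem_compl, Finset.mem_filter, Finset.mem_univ, true_and,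
              not_le] at hi
            exact hi.le
          gcongr
      _ ≤ ∑ i, ‖e.repr v i‖ ^ 2 * κ ^ 2 :=
          Finset.sum_le_sum_of_subset_of_nonneg (Finset.subset_univ _) fun _ _ _ => by positivity
      _ = κ ^ 2 * ‖v‖ ^ 2 := by
          rw [← Finset.sum_mul, mul_comm, ← EuclideanSpace.norm_sq_eq, LinearIsometryEquiv.norm_map]

/-- A separated family of almost fixed vectors of an operator with small Hilbert–Schmidt norm is
small. -/
theorem card_le_rpow_of_almost_fixed {E ι : Type*} [NormedAddCommGroup E] [InnerProductSpace ℂ E]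
    [FiniteDimensional ℂ E] [Fintype ι] (b : OrthonormalBasis ι ℂ E) (T : E →ₗ[ℂ] E)
    {κ ε R r : ℝ} (hκ : 0 < κ) (hR : 0 ≤ R) (hr : 0 < r) (hεr : ε + κ * R ≤ r / 4)
    (s : Finset E) (hs : ∀ c ∈ s, ‖c‖ ≤ R) (hT : ∀ c ∈ s, ‖c - T c‖ ≤ ε)
    (hsep : ∀ c ∈ s, ∀ d ∈ s, c ≠ d → r ≤ ‖c - d‖) :
    (s.card : ℝ) ≤ (1 + 4 * R / r) ^ (2 * ((∑ j, ‖T (b j)‖ ^ 2) / κ ^ 2)) := by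
  classical
  obtain ⟨W, hW, hTW⟩ := exists_submodule_approx b T hκ
  -- Almost fixed vectors are within `ε + κ R ≤ r / 4` of `W`, so projecting to `W` keeps them `r /
  -- 2`-separated and the packing bound applies in the small space `W`.
  let p : E → W := fun c => W.orthogonalProjectionOnto c
  have hp : ∀ c ∈ s, ‖c - (p c : E)‖ ≤ r / 4 := by
    intro c hc
    obtain ⟨w, hw, hcw⟩ := hTW c
    have h1 : ‖c - (p c : E)‖ ≤ ‖c - w‖ := by
      have := Submodule.starProjection_minimal (U := W) c
      rw [Submodule.starProjection_apply] at this
      rw [this]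
      exact ciInf_le ⟨0, by rintro _ ⟨x, rfl⟩; exact norm_nonneg _⟩ (⟨w, hw⟩ : W)
    have h2 : ‖c - w‖ ≤ ‖c - T c‖ + ‖T c - w‖ := norm_sub_le_norm_sub_add_norm_sub _ _ _
    have h3 := hs c hc
    have h4 := hT c hc
    have h5 : κ * ‖c‖ ≤ κ * R := by gcongr
    linarith
  have hps : ∀ c ∈ s, ∀ d ∈ s, c ≠ d → r / 2 ≤ ‖p c - p d‖ := by
    intro c hc d hd hcd
    have h1 := hsep c hc d hd hcd
    have h2 := hp c hc
    have h3 := hp d hd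
    have h4 : c - d = (c - (p c : E)) + ((p c : E) - p d) - (d - (p d : E)) := by abel
    have h5 : ‖c - d‖ ≤ ‖c - (p c : E)‖ + ‖(p c : E) - p d‖ + ‖d - (p d : E)‖ := by
      rw [h4]
      exact (norm_sub_le _ _).trans (by gcongr; exact norm_add_le _ _)
    have h6 : ‖p c - p d‖ = ‖(p c : E) - p d‖ := rfl
    rw [h6]; linarith
  have hinj : Set.InjOn p s := by
    intro c hc d hd hcd
    by_contra hne
    have := hps c hc d hd hne
    rw [hcd, sub_self, norm_zero] at this
    linarith
  have hcard := card_le_pow_of_separated (s.image p) hR (half_pos hr)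
    (by
      intro _ hc'
      obtain ⟨c, hc, rfl⟩ := Finset.mem_image.1 hc'
      exact (Submodule.norm_orthogonalProjectionOnto_apply_le W c).trans (hs c hc))
    (by
      intro _ hc' _ hd' hcd
      obtain ⟨c, hc, rfl⟩ := Finset.mem_image.1 hc'
      obtain ⟨d, hd, rfl⟩ := Finset.mem_image.1 hd'
      exact hps c hc d hd fun h => hcd (h ▸ rfl))
  -- The real dimension of `W` is twice the complex one; hence the factor 2 in the exponent.
  rw [Finset.card_image_of_injOn hinj, finrank_real_of_complex, ← Real.rpow_natCast] at hcard
  have h1 : 2 * R / (r / 2) = 4 * R / r := by field_simp; ring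
  rw [h1] at hcard
  refine hcard.trans (Real.rpow_le_rpow_of_exponent_le ?_ ?_)
  · have : 0 ≤ 4 * R / r := by positivity
    linarith
  · push_cast
    gcongr
    rwa [le_div_iff₀ (by positivity)]

/-! ## Hamming balls -/

/-- A Chernoff bound: each point of the ball has `t ^ hammingDist ≥ t ^ (θ d)`, while the sum of `t
^ hammingDist` over all labellings factors over the coordinates, each factor being at most `1 + k
t`. -/
theorem card_hammingBall_mul_rpow_le {d k : ℕ} (a : Fin d → Fin k) {t θ : ℝ} (ht : 0 < t)
    (ht1 : t ≤ 1) :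
    ((Finset.univ.filter fun a' : Fin d → Fin k => (hammingDist a a' : ℝ) ≤ θ * d).card : ℝ) *
      t ^ (θ * d) ≤ (1 + k * t) ^ d := by
  have h1 : ∀ a' : Fin d → Fin k,
      t ^ hammingDist a a' = ∏ j, if a j ≠ a' j then t else 1 := by
    intro a'
    rw [hammingDist, Finset.prod_ite]
    simp
  have h2 : ∑ a' : Fin d → Fin k, t ^ hammingDist a a' =
      ∏ j, ∑ x : Fin k, if a j ≠ x then t else 1 := by
    rw [Finset.prod_univ_sum, Fintype.piFinset_univ]
    exact Finset.sum_congr rfl fun a' _ => h1 a'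
  have h3 : ∀ j, (∑ x : Fin k, if a j ≠ x then t else 1) ≤ 1 + k * t := by
    intro j
    calc (∑ x : Fin k, if a j ≠ x then t else 1)
        ≤ ∑ x : Fin k, ((if a j = x then 1 else 0) + t) := by
          refine Finset.sum_le_sum fun x _ => ?_
          split_ifs <;> simp_all [ht.le]
      _ = 1 + k * t := by simp [Finset.sum_add_distrib]
  calc _ = ∑ a' ∈ Finset.univ.filter fun a' : Fin d → Fin k => (hammingDist a a' : ℝ) ≤ θ * d,
        t ^ (θ * d) := by rw [Finset.sum_const, nsmul_eq_mul]
    _ ≤ ∑ a' ∈ Finset.univ.filter fun a' : Fin d → Fin k => (hammingDist a a' : ℝ) ≤ θ * d,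
        t ^ hammingDist a a' := by
      refine Finset.sum_le_sum fun a' ha' => ?_
      rw [← Real.rpow_natCast]
      exact Real.rpow_le_rpow_of_exponent_ge ht ht1 (Finset.mem_filter.1 ha').2
    _ ≤ ∑ a' : Fin d → Fin k, t ^ hammingDist a a' :=
      Finset.sum_le_sum_of_subset_of_nonneg (Finset.subset_univ _) fun _ _ _ => by positivity
    _ ≤ (1 + k * t) ^ d := by
      rw [h2]
      refine (Finset.prod_le_prod (fun j _ => Finset.sum_nonneg fun x _ => ?_)
        fun j _ => h3 j).trans ?_
      · split_ifs <;> positivity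
      · simp

/-- Hamming balls of small radius have small exponential growth rate. -/
theorem exists_card_hammingBall_le (k : ℕ) {η : ℝ} (hη : 0 < η) : ∃ θ > 0, ∀ (d : ℕ)
    (a : Fin d → Fin k),
    ((Finset.univ.filter fun a' : Fin d → Fin k => (hammingDist a a' : ℝ) ≤ θ * d).card : ℝ) ≤
      Real.exp (η * d) := by
  obtain ⟨t, ht, ht1, hkt⟩ : ∃ t : ℝ, 0 < t ∧ t ≤ 1 ∧ k * t ≤ η / 2 := by
    refine ⟨min 1 (η / 2 / (k + 1)), by positivity, min_le_left _ _, ?_⟩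
    calc (k : ℝ) * min 1 (η / 2 / (k + 1)) ≤ (k + 1) * (η / 2 / (k + 1)) := by
          gcongr
          · linarith
          · exact min_le_right _ _
      _ = η / 2 := by field_simp
  have hlog : 0 ≤ -Real.log t := by linarith [Real.log_nonpos ht.le ht1]
  -- The exponent `η` is split evenly between `k t` and `-θ log t`. The 1 keeps the denominator
  -- positive when `t = 1`.
  refine ⟨η / 2 / (1 - Real.log t), div_pos (by positivity) (by linarith), fun d a => ?_⟩
  set θ := η / 2 / (1 - Real.log t) with hθ
  have h1 := card_hammingBall_mul_rpow_le a (θ := θ) ht ht1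
  have h2 : θ * (-Real.log t) ≤ η / 2 := by
    rw [hθ, div_mul_eq_mul_div, div_le_iff₀ (by linarith)]
    nlinarith
  rw [← le_div_iff₀ (by positivity)] at h1
  refine h1.trans ?_
  rw [div_le_iff₀ (by positivity), Real.rpow_def_of_pos ht, ← Real.exp_add]
  calc (1 + k * t : ℝ) ^ d ≤ Real.exp (k * t) ^ d := by
        gcongr
        linarith [Real.add_one_le_exp (k * t : ℝ)]
    _ = Real.exp (d * (k * t)) := (Real.exp_nat_mul _ _).symm
    _ ≤ _ := by
        refine Real.exp_le_exp.2 ?_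
        have hd : (0 : ℝ) ≤ d := Nat.cast_nonneg d
        nlinarith

/-! ## Counting through a net -/

/-- If points with `r`-close images under `c` lie in a common set `N a` with at most `M` elements
and separated families have at most `P` elements, then there are at most `P * M` points. -/
theorem card_le_mul_of_separated {α E : Type*} [DecidableEq α] [NormedAddCommGroup E]
    (A : Finset α) (c : α → E) (N : α → Finset α) {r P M : ℝ} (hr : 0 < r)
    (hM : ∀ a, ((N a).card : ℝ) ≤ M) (hM0 : 0 ≤ M)
    (hN : ∀ a ∈ A, ∀ b ∈ A, ‖c a - c b‖ < r → b ∈ N a)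
    (hP : ∀ s : Finset E, (∀ x ∈ s, ∃ a ∈ A, c a = x) →
      (∀ x ∈ s, ∀ y ∈ s, x ≠ y → r ≤ ‖x - y‖) → (s.card : ℝ) ≤ P) :
    (A.card : ℝ) ≤ P * M := by
  classical
  -- A separated subset `B` of maximal cardinality is a net: the sets `N b` with `b ∈ B` cover `A`.
  let F := A.powerset.filter fun B => ∀ a ∈ B, ∀ b ∈ B, a ≠ b → r ≤ ‖c a - c b‖
  obtain ⟨B, hB, hmax⟩ := F.exists_max_image Finset.card ⟨∅, by simp [F]⟩
  simp only [F, Finset.mem_filter, Finset.mem_powerset] at hB hmax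
  obtain ⟨hBA, hBs⟩ := hB
  have hcov : A ⊆ B.biUnion N := by
    intro a ha
    rw [Finset.mem_biUnion]
    by_contra! hne
    have hfar : ∀ b ∈ B, r ≤ ‖c b - c a‖ := fun b hb => by
      by_contra! hlt
      exact hne b hb (hN b (hBA hb) a ha hlt)
    have haB : a ∉ B := fun h => by
      have := hfar a h
      rw [sub_self, norm_zero] at this
      linarith
    have := hmax (insert a B) ⟨Finset.insert_subset ha hBA, ?_⟩
    · rw [Finset.card_insert_of_notMem haB] at this
      omega
    · intro x hx' y hy' hxy
      rcases Finset.mem_insert.1 hx' with rfl | hx <;> rcases Finset.mem_insert.1 hy' with rfl | hy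
      · exact absurd rfl hxy
      · rw [norm_sub_rev]; exact hfar y hy
      · exact hfar x hx
      · exact hBs x hx y hy hxy
  have hinj : Set.InjOn c B := by
    intro a ha b hb hab
    by_contra hne
    have := hBs a ha b hb hne
    rw [hab, sub_self, norm_zero] at this
    linarith
  have hBP : (B.card : ℝ) ≤ P := by
    rw [← Finset.card_image_of_injOn hinj]
    refine hP _ ?_ ?_
    · intro x hx
      obtain ⟨a, ha, rfl⟩ := Finset.mem_image.1 hx
      exact ⟨a, hBA ha, rfl⟩
    · intro x hx y hy hxy
      obtain ⟨a, ha, rfl⟩ := Finset.mem_image.1 hx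
      obtain ⟨b, hb, rfl⟩ := Finset.mem_image.1 hy
      exact hBs a ha b hb fun h => hxy (h ▸ rfl)
  calc (A.card : ℝ) ≤ ((B.biUnion N).card : ℝ) := by exact_mod_cast Finset.card_le_card hcov
    _ ≤ ∑ b ∈ B, ((N b).card : ℝ) := by exact_mod_cast Finset.card_biUnion_le
    _ ≤ ∑ _b ∈ B, M := Finset.sum_le_sum fun b _ => hM b
    _ = B.card * M := by rw [Finset.sum_const, nsmul_eq_mul]
    _ ≤ P * M := by gcongr

/-! ## Group algebra operators on sofic approximations -/

/-- The operator `c ↦ (j ↦ ∑ f(g) c(σ(g)⁻¹ j))` on `ℂ^d`. -/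
noncomputable def soficOperator {Γ : Type*} {d : ℕ} (σ : Γ → Equiv.Perm (Fin d)) (f : Γ →₀ ℂ) :
    EuclideanSpace ℂ (Fin d) →ₗ[ℂ] EuclideanSpace ℂ (Fin d) where
  toFun c := WithLp.toLp 2 fun j => ∑ g ∈ f.support, f g * c ((σ g)⁻¹ j)
  map_add' c c' := by
    ext j
    simp [mul_add, Finset.sum_add_distrib]
  map_smul' a c := by
    ext j
    simp [Finset.mul_sum, mul_left_comm]

theorem soficOperator_apply {Γ : Type*} {d : ℕ} (σ : Γ → Equiv.Perm (Fin d)) (f : Γ →₀ ℂ)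
    (c : EuclideanSpace ℂ (Fin d)) (j : Fin d) :
    soficOperator σ f c j = ∑ g ∈ f.support, f g * c ((σ g)⁻¹ j) := rfl

theorem soficOperator_basisFun {Γ : Type*} {d : ℕ} (σ : Γ → Equiv.Perm (Fin d)) (f : Γ →₀ ℂ)
    (k : Fin d) : soficOperator σ f (EuclideanSpace.basisFun (Fin d) ℂ k) =
      ∑ g ∈ f.support, f g • EuclideanSpace.basisFun (Fin d) ℂ (σ g k) := by
  ext j
  rw [soficOperator_apply]
  simp [EuclideanSpace.basisFun_apply, Pi.single_apply, Equiv.symm_apply_eq]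

/-- The image of a basis vector is `∑ f(g) e_{σ(g)k}`, so orthonormality leaves only the pairs with
`σ(g)k = σ(h)k`. -/
theorem norm_soficOperator_basisFun_sq_le {Γ : Type*} {d : ℕ} (σ : Γ → Equiv.Perm (Fin d))
    (f : Γ →₀ ℂ) (k : Fin d) :
    ‖soficOperator σ f (EuclideanSpace.basisFun (Fin d) ℂ k)‖ ^ 2 ≤
      ∑ g ∈ f.support, ∑ h ∈ f.support, ‖f g‖ * ‖f h‖ * if σ g k = σ h k then 1 else 0 := by
  rw [soficOperator_basisFun, sq, ← inner_self_eq_norm_mul_norm (𝕜 := ℂ)]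
  refine (RCLike.re_le_norm _).trans ?_
  rw [sum_inner]
  refine norm_sum_le_of_le _ fun g _ => ?_
  rw [inner_sum]
  refine norm_sum_le_of_le _ fun h _ => ?_
  rw [inner_smul_left, inner_smul_right,
    orthonormal_iff_ite.1 (EuclideanSpace.basisFun (Fin d) ℂ).orthonormal]
  split_ifs <;> simp

theorem SoficApproximation.eventually_d_pos {Γ : Type*} [Group Γ] (S : SoficApproximation Γ) :
    ∀ᶠ i in atTop, 0 < S.d i := by
  -- For `d = 0` the convention `0 / 0 = 0` gives `unifMeas` the value 0, which is excluded
  -- eventually by the limit 1.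
  filter_upwards [(S.tendsto_mul 1 1).eventually (lt_mem_nhds (zero_lt_one))] with i hi
  by_contra h
  have h0 : S.d i = 0 := by omega
  simp [unifMeas, h0] at hi

open Classical in
theorem SoficApproximation.tendsto_eq {Γ : Type*} [Group Γ] (S : SoficApproximation Γ) (g h : Γ) :
    Tendsto (fun i => unifMeas (S.d i) {k | S.σ i g k = S.σ i h k}) atTop
      (𝓝 (if g = h then 1 else 0)) := by
  split_ifs with hgh
  · subst hgh
    refine tendsto_const_nhds.congr' ?_
    filter_upwards [S.eventually_d_pos] with i hi
    have : (S.d i : ℝ) ≠ 0 := by positivity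
    simp [unifMeas, Set.ncard_univ, this]
  · have h1 := (tendsto_const_nhds (x := (1 : ℝ))).sub (S.tendsto_free g h hgh)
    rw [sub_self] at h1
    refine h1.congr' ?_
    filter_upwards [S.eventually_d_pos] with i hi
    have h0 : (S.d i : ℝ) ≠ 0 := by positivity
    have h2 := Set.ncard_add_ncard_compl {k | S.σ i g k = S.σ i h k}
    have h3 : {k | S.σ i g k = S.σ i h k}ᶜ = {k | S.σ i g k ≠ S.σ i h k} := rfl
    rw [h3, Nat.card_eq_fintype_card, Fintype.card_fin] at h2
    rw [unifMeas, unifMeas, sub_eq_iff_eq_add, ← add_div, ← Nat.cast_add, h2, div_self h0]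

/-- Asymptotic freeness kills the off-diagonal coincidences `σ(g)k = σ(h)k`, so the bound on the
normalized squared Hilbert–Schmidt norm converges to `‖f‖²`. -/
theorem SoficApproximation.eventually_hilbertSchmidt_le {Γ : Type*} [Group Γ]
    (S : SoficApproximation Γ) (f : Γ →₀ ℂ) {η : ℝ} (hf : ∑ g ∈ f.support, ‖f g‖ ^ 2 < η) :
    ∀ᶠ i in atTop, ∑ k, ‖soficOperator (S.σ i) f (EuclideanSpace.basisFun _ ℂ k)‖ ^ 2 ≤
      η * S.d i := by
  classical
  have h1 : Tendsto (fun i => ∑ g ∈ f.support, ∑ h ∈ f.support,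
      ‖f g‖ * ‖f h‖ * unifMeas (S.d i) {k | S.σ i g k = S.σ i h k}) atTop
      (𝓝 (∑ g ∈ f.support, ∑ h ∈ f.support, ‖f g‖ * ‖f h‖ * if g = h then 1 else 0)) :=
    tendsto_finsetSum _ fun g _ => tendsto_finsetSum _ fun h _ =>
      (S.tendsto_eq g h).const_mul _
  have h2 : ∑ g ∈ f.support, ∑ h ∈ f.support, ‖f g‖ * ‖f h‖ * (if g = h then (1 : ℝ) else 0) =
      ∑ g ∈ f.support, ‖f g‖ ^ 2 := by
    refine Finset.sum_congr rfl fun g hg => ?_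
    rw [Finset.sum_eq_single g (fun h _ hh => by rw [if_neg hh.symm, mul_zero])
      fun h => absurd hg h, if_pos rfl, mul_one, sq]
  rw [h2] at h1
  filter_upwards [h1.eventually (gt_mem_nhds hf), S.eventually_d_pos] with i hi hd
  have hd0 : (0 : ℝ) < S.d i := by exact_mod_cast hd
  calc _ ≤ ∑ k, ∑ g ∈ f.support, ∑ h ∈ f.support,
        ‖f g‖ * ‖f h‖ * (if S.σ i g k = S.σ i h k then (1 : ℝ) else 0) :=
        Finset.sum_le_sum fun k _ => norm_soficOperator_basisFun_sq_le _ f k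
    _ = (∑ g ∈ f.support, ∑ h ∈ f.support,
          ‖f g‖ * ‖f h‖ * unifMeas (S.d i) {k | S.σ i g k = S.σ i h k}) * S.d i := by
        rw [Finset.sum_comm, Finset.sum_mul]
        refine Finset.sum_congr rfl fun g _ => ?_
        rw [Finset.sum_comm, Finset.sum_mul]
        refine Finset.sum_congr rfl fun h _ => ?_
        rw [← Finset.mul_sum, unifMeas, mul_assoc (‖f g‖ * ‖f h‖), div_mul_cancel₀ _ hd0.ne']
        congr 1
        rw [Set.ncard_eq_toFinset_card', Finset.sum_boole]
        simp
    _ ≤ η * S.d i := by gcongr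

/-! ## Lipschitz cylinder functions -/

/-- `G` depends only on the coordinates in `F`, in a Lipschitz way. -/
def CylinderLipschitz {ι : Type*} (F : Finset ι) (L : ℝ) (G : (ι → ℂ) → ℝ) : Prop :=
  ∀ z z', |G z - G z'| ≤ L * ∑ i ∈ F, ‖z i - z' i‖

theorem CylinderLipschitz.mono {ι : Type*} {F F' : Finset ι} {L L' : ℝ} {G : (ι → ℂ) → ℝ}
    (h : CylinderLipschitz F L G) (hF : F ⊆ F') (hL : L ≤ L') (hL' : 0 ≤ L') :
    CylinderLipschitz F' L' G := fun z z' =>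
  (h z z').trans <| by
    calc L * ∑ i ∈ F, ‖z i - z' i‖ ≤ L' * ∑ i ∈ F, ‖z i - z' i‖ := by gcongr
      _ ≤ L' * ∑ i ∈ F', ‖z i - z' i‖ := by
        gcongr

/-- `E` can be approximated in `L¹(P)` by Lipschitz cylinder functions. -/
def IsCylinderApproximable {ι : Type*} (P : Measure (ι → ℂ)) (E : Set (ι → ℂ)) : Prop :=
  ∀ ε : ℝ≥0∞, 0 < ε → ∃ (F : Finset ι) (L : ℝ) (G : (ι → ℂ) → ℝ), 0 ≤ L ∧
    CylinderLipschitz F L G ∧ Measurable G ∧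
    ∫⁻ z, ENNReal.ofReal |E.indicator (fun _ => (1 : ℝ)) z - G z| ∂P ≤ ε

theorem IsCylinderApproximable.compl {ι : Type*} {P : Measure (ι → ℂ)} {E : Set (ι → ℂ)}
    (h : IsCylinderApproximable P E) : IsCylinderApproximable P Eᶜ := by
  intro ε hε
  obtain ⟨F, L, G, hL, hG, hGm, hE⟩ := h ε hε
  refine ⟨F, L, fun z => 1 - G z, hL, fun z z' => ?_, hGm.const_sub 1, ?_⟩
  · rw [sub_sub_sub_cancel_left, abs_sub_comm]
    exact hG z z'
  · refine le_of_eq_of_le (lintegral_congr fun z => ?_) hE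
    congr 1
    by_cases hz : z ∈ E
    · simp [hz, abs_sub_comm]
    · simp [hz]

theorem abs_indicator_union_sub_max_le {α : Type*} (A B : Set α) (z : α) (a b : ℝ) :
    |(A ∪ B).indicator (fun _ => (1 : ℝ)) z - max a b| ≤
      |A.indicator (fun _ => (1 : ℝ)) z - a| + |B.indicator (fun _ => (1 : ℝ)) z - b| := by
  have h1 : (A ∪ B).indicator (fun _ => (1 : ℝ)) z =
      max (A.indicator (fun _ => (1 : ℝ)) z) (B.indicator (fun _ => (1 : ℝ)) z) := by
    by_cases hA : z ∈ A <;> by_cases hB : z ∈ B <;> simp [hA, hB]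
  rw [h1]
  exact (abs_max_sub_max_le_max _ _ _ _).trans
    (max_le (le_add_of_nonneg_right (abs_nonneg _)) (le_add_of_nonneg_left (abs_nonneg _)))

theorem IsCylinderApproximable.union {ι : Type*} {P : Measure (ι → ℂ)} {A B : Set (ι → ℂ)}
    (hAm : MeasurableSet A) (hA : IsCylinderApproximable P A) (hB : IsCylinderApproximable P B) :
    IsCylinderApproximable P (A ∪ B) := by
  classical
  intro ε hε
  obtain ⟨F, L, G, hL, hG, hGm, hE⟩ := hA (ε / 2) (ENNReal.half_pos hε.ne')
  obtain ⟨F', L', G', hL', hG', hGm', hE'⟩ := hB (ε / 2) (ENNReal.half_pos hε.ne')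
  refine ⟨F ∪ F', L + L', fun z => max (G z) (G' z), add_nonneg hL hL', fun z z' => ?_,
    hGm.max hGm', ?_⟩
  · refine (abs_max_sub_max_le_max _ _ _ _).trans (max_le ?_ ?_)
    · exact hG.mono Finset.subset_union_left (by linarith) (by linarith) z z'
    · exact hG'.mono Finset.subset_union_right (by linarith) (by linarith) z z'
  · calc _ ≤ ∫⁻ z, (ENNReal.ofReal |A.indicator (fun _ => (1 : ℝ)) z - G z| +
          ENNReal.ofReal |B.indicator (fun _ => (1 : ℝ)) z - G' z|) ∂P := by
          refine lintegral_mono fun z => ?_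
          dsimp only
          rw [← ENNReal.ofReal_add (abs_nonneg _) (abs_nonneg _)]
          exact ENNReal.ofReal_le_ofReal (abs_indicator_union_sub_max_le A B z _ _)
      _ ≤ ε / 2 + ε / 2 := by
          rw [lintegral_add_left (by
            have : Measurable (A.indicator fun _ => (1 : ℝ)) := measurable_const.indicator hAm
            fun_prop)]
          gcongr
      _ = ε := ENNReal.add_halves ε

theorem isCylinderApproximable_empty {ι : Type*} (P : Measure (ι → ℂ)) :
    IsCylinderApproximable P ∅ := fun ε _ =>
  ⟨∅, 0, fun _ => 0, le_rfl, fun z z' => by simp, measurable_const, by simp⟩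

/-- The partial unions are approximable by `union` and exhaust the countable union up to small
measure. -/
theorem IsCylinderApproximable.iUnion {ι : Type*} {P : Measure (ι → ℂ)} [IsFiniteMeasure P]
    {A : ℕ → Set (ι → ℂ)} (hAm : ∀ n, MeasurableSet (A n))
    (hA : ∀ n, IsCylinderApproximable P (A n)) : IsCylinderApproximable P (⋃ n, A n) := by
  intro ε hε
  have hacc : ∀ n, MeasurableSet (Set.accumulate A n) ∧
      IsCylinderApproximable P (Set.accumulate A n) := by
    intro n
    induction n with
    | zero => simpa using ⟨hAm 0, hA 0⟩
    | succ n ih =>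
      rw [Set.accumulate_succ]
      exact ⟨ih.1.union (hAm _), ih.2.union ih.1 (hA _)⟩
  have hU : MeasurableSet (⋃ n, A n) := MeasurableSet.iUnion hAm
  obtain ⟨n, hn⟩ : ∃ n, P ((⋃ n, A n) \ Set.accumulate A n) < ε / 2 := by
    have h1 : Tendsto (fun n => P ((⋃ n, A n) \ Set.accumulate A n)) atTop
        (𝓝 (P (⋂ n, (⋃ n, A n) \ Set.accumulate A n))) := by
      refine tendsto_measure_iInter_atTop (fun n => (hU.diff (hacc n).1).nullMeasurableSet) ?_
        ⟨0, measure_ne_top _ _⟩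
      exact fun m n hmn => Set.sdiff_subset_sdiff_right (Set.monotone_accumulate hmn)
    rw [← Set.sdiff_iUnion, Set.iUnion_accumulate, Set.sdiff_self, measure_empty] at h1
    exact (h1.eventually (gt_mem_nhds (ENNReal.half_pos hε.ne'))).exists
  obtain ⟨F, L, G, hL, hG, hGm, hE⟩ := (hacc n).2 (ε / 2) (ENNReal.half_pos hε.ne')
  refine ⟨F, L, G, hL, hG, hGm, ?_⟩
  have hD : MeasurableSet ((⋃ n, A n) \ Set.accumulate A n) := hU.diff (hacc n).1
  calc _ ≤ ∫⁻ z, (((⋃ n, A n) \ Set.accumulate A n).indicator (fun _ => (1 : ℝ≥0∞)) z +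
        ENNReal.ofReal |(Set.accumulate A n).indicator (fun _ => (1 : ℝ)) z - G z|) ∂P := by
        refine lintegral_mono fun z => ?_
        dsimp only
        by_cases hz : z ∈ Set.accumulate A n
        · have hz' : z ∈ ⋃ n, A n := by
            rw [← Set.iUnion_accumulate]; exact Set.mem_iUnion.2 ⟨n, hz⟩
          rw [Set.indicator_of_mem hz, Set.indicator_of_mem hz']
          exact le_add_self
        · by_cases hz' : z ∈ ⋃ n, A n
          · rw [Set.indicator_of_mem (show z ∈ (⋃ n, A n) \ Set.accumulate A n from ⟨hz', hz⟩),
              Set.indicator_of_mem hz', Set.indicator_of_notMem hz, zero_sub, abs_neg,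
              ← ENNReal.ofReal_one, ← ENNReal.ofReal_add zero_le_one (abs_nonneg _)]
            refine ENNReal.ofReal_le_ofReal ((abs_sub _ _).trans ?_)
            simp
          · rw [Set.indicator_of_notMem hz', Set.indicator_of_notMem hz]
            exact le_add_self
    _ ≤ ε / 2 + ε / 2 := by
        rw [lintegral_add_left (measurable_const.indicator hD), lintegral_indicator_const hD,
          one_mul]
        gcongr
    _ = ε := ENNReal.add_halves ε

/-- Thickened indicators of `C` are Lipschitz and converge pointwise to the indicator of `closure C
= C`; dominated convergence gives the `L¹` approximation. -/
theorem isCylinderApproximable_eval_preimage {ι : Type*} (P : Measure (ι → ℂ)) [IsFiniteMeasure P]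
    (i : ι) {C : Set ℂ} (hC : IsClosed C) :
    IsCylinderApproximable P ((fun z : ι → ℂ => z i) ⁻¹' C) := by
  intro ε hε
  have hpos : ∀ n : ℕ, (0 : ℝ) < 1 / ((n : ℝ) + 1) := fun n => by positivity
  let T : ℕ → ℂ → ℝ := fun n w => thickenedIndicator (hpos n) C w
  have hTm : ∀ n, Measurable (T n) := fun n =>
    (NNReal.continuous_coe.comp (thickenedIndicator (hpos n) C).continuous).measurable
  have hT1 : ∀ n w, |C.indicator (fun _ => (1 : ℝ)) w - T n w| ≤ 1 := by
    intro n w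
    have h0 : 0 ≤ T n w := NNReal.coe_nonneg _
    have h1 : T n w ≤ 1 := NNReal.coe_le_one.2 (thickenedIndicator_le_one (hpos n) C w)
    rw [abs_le]
    by_cases hw : w ∈ C <;> simp [hw] <;> constructor <;> linarith
  have hlim : Tendsto (fun n => ∫⁻ z, ENNReal.ofReal
      |((fun z : ι → ℂ => z i) ⁻¹' C).indicator (fun _ => (1 : ℝ)) z - T n (z i)| ∂P) atTop
      (𝓝 (∫⁻ _z, 0 ∂P)) := by
    refine tendsto_lintegral_of_dominated_convergence (fun _ => 1) ?_ ?_ (by simp) ?_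
    · intro n
      have h1 : Measurable (((fun z : ι → ℂ => z i) ⁻¹' C).indicator fun _ => (1 : ℝ)) :=
        measurable_const.indicator (measurable_pi_apply i hC.measurableSet)
      have h2 : Measurable fun z : ι → ℂ => T n (z i) := (hTm n).comp (measurable_pi_apply i)
      exact ENNReal.measurable_ofReal.comp (_root_.continuous_abs.measurable.comp (h1.sub h2))
    · intro n
      refine Eventually.of_forall fun z => ?_
      rw [← ENNReal.ofReal_one]
      exact ENNReal.ofReal_le_ofReal (hT1 n (z i))
    · refine Eventually.of_forall fun z => ?_
      have h1 := thickenedIndicator_tendsto_indicator_closure hpos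
        tendsto_one_div_add_atTop_nhds_zero_nat C
      rw [tendsto_pi_nhds] at h1
      have h2 : Tendsto (fun n => T n (z i)) atTop
          (𝓝 (((closure C).indicator (fun _ => (1 : NNReal)) (z i) : NNReal) : ℝ)) :=
        (NNReal.continuous_coe.tendsto _).comp (h1 (z i))
      have h3 : (((closure C).indicator (fun _ => (1 : NNReal)) (z i) : NNReal) : ℝ) =
          ((fun z : ι → ℂ => z i) ⁻¹' C).indicator (fun _ => (1 : ℝ)) z := by
        rw [hC.closure_eq]
        by_cases hz : z i ∈ C <;> simp [hz]
      rw [h3] at h2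
      have h4 := (ENNReal.continuous_ofReal.comp _root_.continuous_abs).tendsto _ |>.comp
        ((tendsto_const_nhds
          (x := ((fun z : ι → ℂ => z i) ⁻¹' C).indicator (fun _ => (1 : ℝ)) z)).sub h2)
      simpa [Function.comp_def] using h4
  rw [lintegral_zero] at hlim
  obtain ⟨n, hn⟩ := (hlim.eventually (gt_mem_nhds hε)).exists
  have hlip := lipschitzWith_thickenedIndicator (hpos n) C
  refine ⟨{i}, ((1 / ((n : ℝ) + 1)).toNNReal⁻¹ : NNReal), fun z => T n (z i), NNReal.coe_nonneg _, fun z z' => ?_,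
    (hTm n).comp (measurable_pi_apply i), hn.le⟩
  rw [Finset.sum_singleton, ← dist_eq_norm]
  exact hlip.dist_le_mul (z i) (z' i)

/-- The approximable measurable sets form a σ-algebra containing the coordinate preimages of closed
sets, which generate the product σ-algebra. -/
theorem isCylinderApproximable_of_measurableSet {ι : Type*} (P : Measure (ι → ℂ))
    [IsFiniteMeasure P] {E : Set (ι → ℂ)} (hE : MeasurableSet E) :
    IsCylinderApproximable P E := by
  let m : MeasurableSpace (ι → ℂ) :=
    { MeasurableSet' := fun A => MeasurableSet A ∧ IsCylinderApproximable P A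
      measurableSet_empty := ⟨MeasurableSet.empty, isCylinderApproximable_empty P⟩
      measurableSet_compl := fun A hA => ⟨hA.1.compl, hA.2.compl⟩
      measurableSet_iUnion := fun A hA =>
        ⟨MeasurableSet.iUnion fun n => (hA n).1,
          IsCylinderApproximable.iUnion (fun n => (hA n).1) fun n => (hA n).2⟩ }
  have hle : MeasurableSpace.pi ≤ m := by
    refine iSup_le fun i => ?_
    rw [← measurable_iff_comap_le]
    exact measurable_of_isClosed fun C hC =>
      ⟨measurable_pi_apply i hC.measurableSet, isCylinderApproximable_eval_preimage P i hC⟩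
  exact (hle E hE).2

/-! ## Statistics of microstates -/

namespace SoficEntropy

variable {Γ X : Type*} [Group Γ] [MeasurableSpace X] [MulAction Γ X] [MeasurableConstSMul Γ X]

theorem measurable_itinerary {m : ℕ} {β : X → Fin m} (hβ : Measurable β) (F : Finset Γ) :
    Measurable (itinerary β F) :=
  measurable_pi_lambda _ fun g => hβ.comp (measurable_const_smul (g : Γ)⁻¹)

theorem sum_eq_sum_card {d : ℕ} {A : Type*} [Fintype A] (H : A → ℝ) (φ : Fin d → A) :
    ∑ j, H (φ j) = ∑ a, ((φ ⁻¹' {a}).ncard : ℝ) * H a := by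
  classical
  have : ∀ j, H (φ j) = ∑ a, if φ j = a then H a else 0 := fun j => by simp
  simp_rw [this]
  rw [Finset.sum_comm]
  refine Finset.sum_congr rfl fun a _ => ?_
  rw [Set.ncard_eq_toFinset_card', Finset.sum_ite, Finset.sum_const_zero, add_zero,
    Finset.sum_const, nsmul_eq_mul]
  congr 2
  simp [Set.preimage, Set.toFinset_ofPred]

/-- Sums over a microstate `φ` of functions of `φ(j)(e)` and of the values
`g ↦ φ(σ(g)⁻¹ j)(e)` are close to the corresponding integrals. -/
theorem eventually_sum_le_of_mem_AP (μ : Measure X) [IsProbabilityMeasure μ] {m : ℕ}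
    {β : X → Fin m} (hβ : Measurable β) (F : Finset Γ) (hF : (1 : Γ) ∈ F)
    (H : Fin m → (F → Fin m) → ℝ) {I : ℝ} (hI : ∫ x, H (β x) (itinerary β F x) ∂μ < I) :
    ∀ᶠ δ in 𝓝[>] (0 : ℝ), ∀ (d : ℕ) (σ : Γ → Equiv.Perm (Fin d)), ∀ φ ∈ AP μ β F hF δ σ,
      ∑ j, H (φ j ⟨1, hF⟩) (fun g => φ ((σ g)⁻¹ j) ⟨1, hF⟩) ≤ I * d := by
  classical
  obtain ⟨C, hC0, hC⟩ : ∃ C : ℝ, 0 ≤ C ∧ ∀ x a, |H x a| ≤ C :=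
    ⟨∑ x, ∑ a, |H x a|, by positivity, fun x a =>
      (Finset.single_le_sum (f := fun a => |H x a|) (fun _ _ => abs_nonneg _)
        (Finset.mem_univ a)).trans (Finset.single_le_sum (f := fun x => ∑ a, |H x a|)
          (fun _ _ => Finset.sum_nonneg fun _ _ => abs_nonneg _) (Finset.mem_univ x))⟩
  set J := ∫ x, H (β x) (itinerary β F x) ∂μ with hJ
  -- With `C` a bound for `|H|`, the `ℓ¹` discrepancy costs `C δ` per point, and each `g ∈ F` costs
  -- at most `2 C` on the fraction `δ` of points where equivariance fails.
  have hsmall : ∀ᶠ δ in 𝓝[>] (0 : ℝ), J + (1 + 2 * F.card) * C * δ < I := by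
    have h1 : Tendsto (fun δ : ℝ => J + (1 + 2 * F.card) * C * δ) (𝓝[>] 0) (𝓝 J) := by
      have h2 : Continuous fun δ : ℝ => J + (1 + 2 * F.card) * C * δ := by fun_prop
      have h3 := h2.tendsto 0
      simp only [mul_zero, add_zero] at h3
      exact h3.mono_left nhdsWithin_le_nhds
    exact h1.eventually (gt_mem_nhds hI)
  filter_upwards [hsmall, self_mem_nhdsWithin] with δ hδI hδ d σ φ hφ
  rcases Nat.eq_zero_or_pos d with rfl | hd
  · simp
  have hd0 : (0 : ℝ) < d := by exact_mod_cast hd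
  let H' : (F → Fin m) → ℝ := fun a => H (a ⟨1, hF⟩) a
  have hJ' : J = ∑ a, μ.real (itinerary β F ⁻¹' {a}) * H' a := by
    have h1 : J = ∫ x, H' (itinerary β F x) ∂μ := by
      refine integral_congr_ae (Eventually.of_forall fun x => ?_)
      simp [H', itinerary]
    have hm := measurable_itinerary (Γ := Γ) hβ F
    have := Measure.isProbabilityMeasure_map (μ := μ) hm.aemeasurable
    rw [h1, ← integral_map (f := H') hm.aemeasurable (measurable_of_finite _).aestronglyMeasurable,
      integral_fintype (Integrable.of_finite)]
    refine Finset.sum_congr rfl fun a _ => ?_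
    rw [map_measureReal_apply hm (measurableSet_singleton a), smul_eq_mul]
  have hφ1 : ∑ j, H' (φ j) ≤ (J + C * δ) * d := by
    have h1 : ∑ j, H' (φ j) = (∑ a, unifMeas d (φ ⁻¹' {a}) * H' a) * d := by
      rw [sum_eq_sum_card, Finset.sum_mul]
      refine Finset.sum_congr rfl fun a _ => ?_
      rw [unifMeas, mul_right_comm, div_mul_cancel₀ _ hd0.ne']
    rw [h1]
    refine mul_le_mul_of_nonneg_right ?_ hd0.le
    rw [hJ', ← sub_le_iff_le_add', ← Finset.sum_sub_distrib]
    calc _ ≤ ∑ a, C * |unifMeas d (φ ⁻¹' {a}) - μ.real (itinerary β F ⁻¹' {a})| := by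
          refine Finset.sum_le_sum fun a _ => ?_
          rw [← sub_mul]
          refine (le_abs_self _).trans ?_
          rw [abs_mul, mul_comm]
          gcongr
          exact hC _ _
      _ ≤ C * δ := by
          rw [← Finset.mul_sum]
          gcongr
          exact hφ.1.le
  have hφ2 : ∑ j, H (φ j ⟨1, hF⟩) (fun g => φ ((σ g)⁻¹ j) ⟨1, hF⟩) - ∑ j, H' (φ j) ≤
      2 * F.card * C * δ * d := by
    rw [← Finset.sum_sub_distrib]
    calc _ ≤ ∑ j, ∑ g : F, if φ j g ≠ φ ((σ g)⁻¹ j) ⟨1, hF⟩ then 2 * C else 0 := by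
          refine Finset.sum_le_sum fun j _ => ?_
          by_cases hj : ∀ g : F, φ j g = φ ((σ g)⁻¹ j) ⟨1, hF⟩
          · have h2 : (fun g : F => φ ((σ g)⁻¹ j) ⟨1, hF⟩) = φ j := (funext hj).symm
            rw [h2, sub_self]
            exact Finset.sum_nonneg fun _ _ => by split_ifs <;> positivity
          · push Not at hj
            obtain ⟨g, hg⟩ := hj
            calc _ ≤ 2 * C := by
                  have h3 := abs_le.1 (hC (φ j ⟨1, hF⟩) (fun g => φ ((σ g)⁻¹ j) ⟨1, hF⟩))
                  have h4 := abs_le.1 (hC (φ j ⟨1, hF⟩) (φ j))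
                  simp only [H']
                  linarith
              _ = if φ j g ≠ φ ((σ g)⁻¹ j) ⟨1, hF⟩ then 2 * C else 0 := by rw [if_pos hg]
              _ ≤ _ := Finset.single_le_sum
                  (f := fun g : F => if φ j g ≠ φ ((σ g)⁻¹ j) ⟨1, hF⟩ then 2 * C else 0)
                  (fun _ _ => by split_ifs <;> positivity) (Finset.mem_univ g)
      _ = ∑ g : F, ({j | φ j g ≠ φ ((σ g)⁻¹ j) ⟨1, hF⟩}.ncard : ℝ) * (2 * C) := by
          rw [Finset.sum_comm]
          refine Finset.sum_congr rfl fun g _ => ?_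
          rw [Finset.sum_ite, Finset.sum_const_zero, add_zero, Finset.sum_const, nsmul_eq_mul,
            Set.ncard_eq_toFinset_card', Set.toFinset_ofPred]
      _ ≤ ∑ _g : F, (δ * d) * (2 * C) := by
          refine Finset.sum_le_sum fun g _ => ?_
          have := (hφ.2 g).le
          rw [unifMeas, div_le_iff₀ hd0] at this
          gcongr
      _ = 2 * F.card * C * δ * d := by
          rw [Finset.sum_const, Finset.card_univ, Fintype.card_coe, nsmul_eq_mul]; ring
  calc _ ≤ (J + C * δ) * d + 2 * F.card * C * δ * d := by linarith
    _ = (J + (1 + 2 * F.card) * C * δ) * d := by ring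
    _ ≤ I * d := by gcongr

end SoficEntropy

/-! ## Counting microstates -/

theorem hammingDist_le_sum_abs {d k : ℕ} (a a' : Fin d → Fin k) :
    (hammingDist a a' : ℝ) ≤
      ∑ i, ∑ j, |(if a j = i then (1 : ℝ) else 0) - if a' j = i then 1 else 0| := by
  rw [Finset.sum_comm, hammingDist, ← Finset.sum_boole]
  refine Finset.sum_le_sum fun j _ => ?_
  split_ifs with h
  · refine le_of_eq_of_le ?_ (Finset.single_le_sum (f := fun i =>
      |(if a j = i then (1 : ℝ) else 0) - if a' j = i then 1 else 0|)
      (fun _ _ => abs_nonneg _) (Finset.mem_univ (a j)))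
    simp [Ne.symm h]
  · exact Finset.sum_nonneg fun _ _ => abs_nonneg _

theorem EuclideanSpace.sum_norm_le_sqrt_mul_norm {d : ℕ} (c : EuclideanSpace ℂ (Fin d)) :
    ∑ j, ‖c j‖ ≤ √d * ‖c‖ := by
  refine (sq_le_sq₀ (Finset.sum_nonneg fun _ _ => norm_nonneg _) (by positivity)).1 ?_
  rw [mul_pow, Real.sq_sqrt (Nat.cast_nonneg d), EuclideanSpace.norm_sq_eq]
  simpa using sq_sum_le_card_mul_sum_sq (s := Finset.univ) (f := fun j => ‖c j‖)

/-- Labellings that are almost given by the same Lipschitz cylinder functions of two nearby vectors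
are close in the Hamming distance. -/
theorem hammingDist_le_of_cylinderLipschitz {Γ : Type*} {d k : ℕ} (σ : Γ → Equiv.Perm (Fin d))
    {F : Fin k → Finset Γ} {L : Fin k → ℝ} {G : Fin k → (Γ → ℂ) → ℝ}
    (hL : ∀ i, 0 ≤ L i) (hG : ∀ i, CylinderLipschitz (F i) (L i) (G i))
    {κ r : ℝ} {a a' : Fin d → Fin k} {c c' : EuclideanSpace ℂ (Fin d)}
    (ha : ∀ i, ∑ j, |(if a j = i then (1 : ℝ) else 0) - G i fun g => c ((σ g)⁻¹ j)| ≤ κ * d)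
    (ha' : ∀ i, ∑ j, |(if a' j = i then (1 : ℝ) else 0) - G i fun g => c' ((σ g)⁻¹ j)| ≤ κ * d)
    (hc : ‖c - c'‖ ≤ r * √d) :
    (hammingDist a a' : ℝ) ≤ (k * (2 * κ) + r * ∑ i, L i * (F i).card) * d := by
  refine (hammingDist_le_sum_abs a a').trans ?_
  have hi : ∀ i, ∑ j, |(if a j = i then (1 : ℝ) else 0) - if a' j = i then 1 else 0| ≤
      (2 * κ + r * (L i * (F i).card)) * d := by
    intro i
    -- Each `σ g` is a permutation, so every `g ∈ F i` contributes the full `ℓ¹` norm of `c - c'`;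
    -- Cauchy–Schwarz bounds it by `√d ‖c - c'‖ ≤ r d`.
    have h1 : ∑ j, |(G i fun g => c ((σ g)⁻¹ j)) - G i fun g => c' ((σ g)⁻¹ j)| ≤
        r * (L i * (F i).card) * d := by
      calc _ ≤ ∑ j, L i * ∑ g ∈ F i, ‖c ((σ g)⁻¹ j) - c' ((σ g)⁻¹ j)‖ :=
            Finset.sum_le_sum fun j _ => hG i _ _
        _ = L i * ∑ g ∈ F i, ∑ j, ‖(c - c') ((σ g)⁻¹ j)‖ := by
            rw [← Finset.mul_sum, Finset.sum_comm]; rfl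
        _ = L i * ∑ _g ∈ F i, ∑ j, ‖(c - c') j‖ := by
            congr 1
            exact Finset.sum_congr rfl fun g _ =>
              Equiv.sum_comp (σ g)⁻¹ fun j => ‖(c - c') j‖
        _ = L i * (F i).card * ∑ j, ‖(c - c') j‖ := by
            rw [Finset.sum_const, nsmul_eq_mul, mul_assoc]
        _ ≤ L i * (F i).card * (√d * (r * √d)) := by
            have := hL i
            gcongr
            exact (EuclideanSpace.sum_norm_le_sqrt_mul_norm _).trans (by gcongr)
        _ = r * (L i * (F i).card) * (√d * √d) := by ring
        _ = _ := by rw [Real.mul_self_sqrt (Nat.cast_nonneg d)]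
    calc _ ≤ ∑ j, (|(if a j = i then (1 : ℝ) else 0) - G i fun g => c ((σ g)⁻¹ j)| +
          |(if a' j = i then (1 : ℝ) else 0) - G i fun g => c' ((σ g)⁻¹ j)| +
          |(G i fun g => c ((σ g)⁻¹ j)) - G i fun g => c' ((σ g)⁻¹ j)|) := by
          refine Finset.sum_le_sum fun j _ => ?_
          generalize (if a j = i then (1 : ℝ) else 0) = p
          generalize (if a' j = i then (1 : ℝ) else 0) = q
          generalize (G i fun g => c ((σ g)⁻¹ j)) = u
          generalize (G i fun g => c' ((σ g)⁻¹ j)) = w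
          have e : p - q = (p - u) - (q - w) + (u - w) := by ring
          rw [e]
          exact (abs_add_le _ _).trans (by gcongr; exact abs_sub _ _)
      _ ≤ κ * d + κ * d + r * (L i * (F i).card) * d := by
          rw [Finset.sum_add_distrib, Finset.sum_add_distrib]
          exact add_le_add (add_le_add (ha i) (ha' i)) h1
      _ = _ := by ring
  calc _ ≤ ∑ i, (2 * κ + r * (L i * (F i).card)) * d := Finset.sum_le_sum fun i _ => hi i
    _ = _ := by
      rw [← Finset.sum_mul, Finset.sum_add_distrib, Finset.sum_const, Finset.card_univ,
        Fintype.card_fin, nsmul_eq_mul, Finset.mul_sum]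

/-- The number of labellings of `{1, …, d}` that are almost Lipschitz cylinder functions of bounded
vectors almost fixed by an operator of small Hilbert–Schmidt norm. -/
theorem card_le_exp_of_almost_fixed {Γ : Type*} {d k : ℕ} (hd : 0 < d)
    (σ : Γ → Equiv.Perm (Fin d))
    (T : EuclideanSpace ℂ (Fin d) →ₗ[ℂ] EuclideanSpace ℂ (Fin d))
    {F : Fin k → Finset Γ} {L : Fin k → ℝ} {G : Fin k → (Γ → ℂ) → ℝ}
    (hL : ∀ i, 0 ≤ L i) (hG : ∀ i, CylinderLipschitz (F i) (L i) (G i))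
    {η θ κ r R : ℝ} (hr : 0 < r) (hR : 0 < R)
    (hθ : k * (2 * κ) + r * ∑ i, L i * (F i).card ≤ θ)
    (hball : ∀ a : Fin d → Fin k,
      ((Finset.univ.filter fun a' : Fin d → Fin k => (hammingDist a a' : ℝ) ≤ θ * d).card : ℝ) ≤
        Real.exp (η * d))
    {τ : ℝ} (hτ : 2 * (τ / (r / (8 * R)) ^ 2) * Real.log (1 + 4 * R / r) ≤ η)
    (hT : ∑ j, ‖T (EuclideanSpace.basisFun _ ℂ j)‖ ^ 2 ≤ τ * d)
    (A : Finset (Fin d → Fin k)) (c : (Fin d → Fin k) → EuclideanSpace ℂ (Fin d))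
    (hcR : ∀ a ∈ A, ‖c a‖ ≤ R * √d) (hcT : ∀ a ∈ A, ‖c a - T (c a)‖ ≤ r / 8 * √d)
    (hcG : ∀ a ∈ A, ∀ i,
      ∑ j, |(if a j = i then (1 : ℝ) else 0) - G i fun g => c a ((σ g)⁻¹ j)| ≤ κ * d) :
    (A.card : ℝ) ≤ Real.exp (2 * η * d) := by
  have hsd : 0 < √(d : ℝ) := Real.sqrt_pos.2 (by exact_mod_cast hd)
  have hd0 : (0 : ℝ) < d := by exact_mod_cast hd
  have hexp : Real.exp (2 * η * d) = Real.exp (η * d) * Real.exp (η * d) := by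
    rw [← Real.exp_add]; ring_nf
  rw [hexp]
  -- One factor `exp (η d)` bounds the separated families of vectors, the other the Hamming ball of
  -- labellings around each.
  refine card_le_mul_of_separated A c
    (fun a => Finset.univ.filter fun a' : Fin d → Fin k => (hammingDist a a' : ℝ) ≤ θ * d)
    (mul_pos hr hsd) hball (Real.exp_pos _).le ?_ ?_
  · intro a ha b hb hab
    rw [Finset.mem_filter]
    refine ⟨Finset.mem_univ _, (hammingDist_le_of_cylinderLipschitz σ hL hG (hcG a ha) (hcG b hb)
      hab.le).trans ?_⟩
    gcongr
  · intro s hs hsep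
    -- Truncation at level `r / (8R)` costs `(r / 8) √d` on the ball of radius `R √d`; with the
    -- defect `(r / 8) √d` this makes up the permitted quarter of the separation.
    have h1 := card_le_rpow_of_almost_fixed (EuclideanSpace.basisFun (Fin d) ℂ) T
      (κ := r / (8 * R)) (ε := r / 8 * √d) (R := R * √d) (r := r * √d) (by positivity)
      (by positivity) (by positivity) (by
        have : r / (8 * R) * (R * √d) = r / 8 * √d := by field_simp
        rw [this]
        exact le_of_eq (by ring)) s
      (fun x hx => by obtain ⟨a, ha, rfl⟩ := hs x hx; exact hcR a ha)
      (fun x hx => by obtain ⟨a, ha, rfl⟩ := hs x hx; exact hcT a ha) hsep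
    have h2 : 4 * (R * √d) / (r * √d) = 4 * R / r := by field_simp
    rw [h2] at h1
    have h3 : 0 < 1 + 4 * R / r := by positivity
    have h4 : 0 ≤ Real.log (1 + 4 * R / r) :=
      Real.log_nonneg (by have : 0 ≤ 4 * R / r := by positivity
                          linarith)
    refine h1.trans ?_
    rw [Real.rpow_def_of_pos h3]
    refine Real.exp_le_exp.2 ?_
    calc _ ≤ Real.log (1 + 4 * R / r) * (2 * (τ * d / (r / (8 * R)) ^ 2)) := by gcongr
      _ = 2 * (τ / (r / (8 * R)) ^ 2) * Real.log (1 + 4 * R / r) * d := by ring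
      _ ≤ η * d := by gcongr

/-! ## `L²` estimates -/

theorem integral_norm_sq_le_of_eLpNorm_le {X : Type*} [MeasurableSpace X] {μ : Measure X}
    {w : X → ℂ} (hw : MemLp w 2 μ) {ε : ℝ} (hε : 0 ≤ ε)
    (h : eLpNorm w 2 μ ≤ ENNReal.ofReal ε) : ∫ x, ‖w x‖ ^ 2 ∂μ ≤ ε ^ 2 := by
  rw [hw.eLpNorm_eq_integral_rpow_norm (by norm_num) (by norm_num),
    ENNReal.ofReal_le_ofReal_iff hε] at h
  have h0 : 0 ≤ ∫ x, ‖w x‖ ^ (2 : ℝ≥0∞).toReal ∂μ := integral_nonneg fun x => by positivity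
  have h1 := pow_le_pow_left₀ (Real.rpow_nonneg h0 _) h 2
  rw [← Real.rpow_natCast, ← Real.rpow_mul h0] at h1
  simpa using h1

theorem integral_norm_le_of_eLpNorm_le {X : Type*} [MeasurableSpace X] {μ : Measure X}
    [IsProbabilityMeasure μ] {w : X → ℂ} (hw : MemLp w 2 μ) {ε : ℝ} (hε : 0 ≤ ε)
    (h : eLpNorm w 2 μ ≤ ENNReal.ofReal ε) : ∫ x, ‖w x‖ ∂μ ≤ ε := by
  have h1 : eLpNorm w 1 μ ≤ ENNReal.ofReal ε :=
    (eLpNorm_le_eLpNorm_of_exponent_le (by norm_num) hw.1).trans h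
  rw [eLpNorm_one_eq_lintegral_enorm, ← ofReal_integral_norm_eq_lintegral_enorm
    (hw.integrable (by norm_num)), ENNReal.ofReal_le_ofReal_iff hε] at h1
  exact h1

/-- Every finite observable is refined by one of which a given `L²` function is almost a
function. -/
theorem exists_refinement {X : Type*} [MeasurableSpace X] {μ : Measure X} {ζ : X → ℂ}
    (hζ : MemLp ζ 2 μ) {k : ℕ} {α : X → Fin k} (hα : Measurable α) {ε : ℝ} (hε : 0 < ε) :
    ∃ (m : ℕ) (β : X → Fin m) (pr : Fin m → Fin k) (v : Fin m → ℂ), Measurable β ∧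
      (∀ x, pr (β x) = α x) ∧ eLpNorm (fun x => ζ x - v (β x)) 2 μ ≤ ENNReal.ofReal ε := by
  obtain ⟨s, hs, -⟩ := hζ.exists_simpleFunc_eLpNorm_sub_lt (by norm_num)
    (ε := ENNReal.ofReal ε) (by simpa using hε)
  -- The refinement records both the label and the value of an approximating simple function.
  let e : (Fin k × s.range) ≃ Fin (Fintype.card (Fin k × s.range)) := Fintype.equivFin _
  refine ⟨_, fun x => e (α x, ⟨s x, s.mem_range_self x⟩), fun b => (e.symm b).1,
    fun b => ((e.symm b).2 : ℂ), ?_, fun x => by simp, ?_⟩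
  · have h1 : Measurable fun x => (α x, (⟨s x, s.mem_range_self x⟩ : s.range)) :=
      hα.prodMk (s.measurable.subtype_mk)
    exact (Measurable.of_discrete (f := e)).comp h1
  · simp only [Equiv.symm_apply_apply]
    exact hs.le

/-- The `L²` version of a singular vector, for functions on a `Γ`-space. -/
def IsSingularFunction (Γ : Type*) {X : Type*} [Group Γ] [MeasurableSpace X] [MulAction Γ X]
    (μ : Measure X) (ζ : X → ℂ) : Prop :=
  ∀ ε > 0, ∃ f : Γ →₀ ℂ,
    eLpNorm (fun x => ∑ g ∈ f.support, f g * ζ (g⁻¹ • x) - ζ x) 2 μ ≤ ENNReal.ofReal ε ∧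
      ∑ g ∈ f.support, ‖f g‖ ^ 2 < ε ^ 2

section Koopman

variable {Γ X : Type*} [Group Γ] [MeasurableSpace X] [MulAction Γ X] [MeasurableConstSMul Γ X]
  {μ : Measure X} [SMulInvariantMeasure Γ X μ]

theorem MeasureTheory.MemLp.groupAlgebra_sub {w : X → ℂ} (hw : MemLp w 2 μ) (f : Γ →₀ ℂ) :
    MemLp (fun x => ∑ g ∈ f.support, f g * w (g⁻¹ • x) - w x) 2 μ :=
  (memLp_finsetSum _ fun g _ => (hw.comp_measurePreserving
    (measurePreserving_smul g⁻¹ μ)).const_mul (f g)).sub hw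

theorem eLpNorm_groupAlgebra_sub_le {w : X → ℂ} (hw : MemLp w 2 μ) (f : Γ →₀ ℂ) {ε : ℝ}
    (hε : 0 ≤ ε) (h : eLpNorm w 2 μ ≤ ENNReal.ofReal ε) :
    eLpNorm (fun x => ∑ g ∈ f.support, f g * w (g⁻¹ • x) - w x) 2 μ ≤
      ENNReal.ofReal ((∑ g ∈ f.support, ‖f g‖ + 1) * ε) := by
  have hg : ∀ g : Γ, MemLp (fun x => f g * w (g⁻¹ • x)) 2 μ := fun g =>
    (hw.comp_measurePreserving (measurePreserving_smul g⁻¹ μ)).const_mul (f g)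
  have hn : ∀ g : Γ, eLpNorm (fun x => f g * w (g⁻¹ • x)) 2 μ ≤ ENNReal.ofReal (‖f g‖ * ε) := by
    intro g
    have h1 : eLpNorm (fun x => w (g⁻¹ • x)) 2 μ = eLpNorm w 2 μ :=
      eLpNorm_comp_measurePreserving hw.1 (measurePreserving_smul g⁻¹ μ)
    have h2 := eLpNorm_const_smul (f g) (fun x => w (g⁻¹ • x)) 2 μ
    rw [ENNReal.ofReal_mul (norm_nonneg _), ofReal_norm]
    calc _ = ‖f g‖ₑ * eLpNorm w 2 μ := by rw [← h1, ← h2]; rfl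
      _ ≤ _ := by gcongr
  have hs : eLpNorm (∑ g ∈ f.support, fun x => f g * w (g⁻¹ • x)) 2 μ ≤
      ENNReal.ofReal (∑ g ∈ f.support, ‖f g‖ * ε) := by
    rw [ENNReal.ofReal_sum_of_nonneg fun g _ => by positivity]
    exact (eLpNorm_sum_le (fun g _ => (hg g).1) (by norm_num)).trans
      (Finset.sum_le_sum fun g _ => hn g)
  have he : (fun x => ∑ g ∈ f.support, f g * w (g⁻¹ • x) - w x) =
      (∑ g ∈ f.support, fun x => f g * w (g⁻¹ • x)) - w := by
    ext x; simp [Finset.sum_apply]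
  rw [he, add_mul, one_mul, Finset.sum_mul, ENNReal.ofReal_add
    (Finset.sum_nonneg fun g _ => by positivity) hε]
  refine (eLpNorm_sub_le ?_ hw.1 (by norm_num)).trans (add_le_add hs h)
  exact Finset.aestronglyMeasurable_sum _ fun g _ => (hg g).1

/-- With `T` the operator of `f`, `T w - w` is `(T ζ - ζ) - (T - 1)(ζ - w)`, and `T - 1` has norm at
most `∑ ‖f g‖ + 1`. -/
theorem integral_norm_groupAlgebra_sub_sq_le {ζ w : X → ℂ} (hζ : MemLp ζ 2 μ) (hw : MemLp w 2 μ)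
    (f : Γ →₀ ℂ) {ε ε' : ℝ} (hε : 0 ≤ ε) (hε' : 0 ≤ ε')
    (hf : eLpNorm (fun x => ∑ g ∈ f.support, f g * ζ (g⁻¹ • x) - ζ x) 2 μ ≤ ENNReal.ofReal ε)
    (hd : eLpNorm (fun x => ζ x - w x) 2 μ ≤ ENNReal.ofReal ε') :
    ∫ x, ‖∑ g ∈ f.support, f g * w (g⁻¹ • x) - w x‖ ^ 2 ∂μ ≤
      (ε + (∑ g ∈ f.support, ‖f g‖ + 1) * ε') ^ 2 := by
  have hS : 0 ≤ ∑ g ∈ f.support, ‖f g‖ := Finset.sum_nonneg fun _ _ => norm_nonneg _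
  refine integral_norm_sq_le_of_eLpNorm_le (hw.groupAlgebra_sub f) (by positivity) ?_
  have he : (fun x => ∑ g ∈ f.support, f g * w (g⁻¹ • x) - w x) =
      (fun x => ∑ g ∈ f.support, f g * ζ (g⁻¹ • x) - ζ x) -
        fun x => ∑ g ∈ f.support, f g * (ζ - w) (g⁻¹ • x) - (ζ - w) x := by
    ext x
    simp only [Pi.sub_apply, mul_sub, Finset.sum_sub_distrib]
    ring
  rw [he, ENNReal.ofReal_add hε (by positivity)]
  refine (eLpNorm_sub_le (hζ.groupAlgebra_sub f).1 ((hζ.sub hw).groupAlgebra_sub f).1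
    (by norm_num)).trans (add_le_add hf (eLpNorm_groupAlgebra_sub_le (hζ.sub hw) f hε' hd))

theorem integral_abs_indicator_sub_le [IsProbabilityMeasure μ] {ζ w : X → ℂ} (hζ : MemLp ζ 2 μ)
    (hw : MemLp w 2 μ) {F : Finset Γ} {L : ℝ} {G : (Γ → ℂ) → ℝ} (hL : 0 ≤ L)
    (hG : CylinderLipschitz F L G) {u : X → ℝ}
    (hu : Integrable (fun x => u x - G fun g => ζ (g⁻¹ • x)) μ)
    (hu' : Integrable (fun x => u x - G fun g => w (g⁻¹ • x)) μ) {κ ε : ℝ} (hε : 0 ≤ ε)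
    (hκ : ∫ x, |u x - G fun g => ζ (g⁻¹ • x)| ∂μ ≤ κ)
    (hd : eLpNorm (fun x => ζ x - w x) 2 μ ≤ ENNReal.ofReal ε) :
    ∫ x, |u x - G fun g => w (g⁻¹ • x)| ∂μ ≤ κ + L * F.card * ε := by
  have hD : MemLp (fun x => ζ x - w x) 2 μ := hζ.sub hw
  have hDi : ∀ g : Γ, Integrable (fun x => ‖ζ (g⁻¹ • x) - w (g⁻¹ • x)‖) μ := fun g =>
    ((hD.comp_measurePreserving (measurePreserving_smul g⁻¹ μ)).integrable (by norm_num)).norm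
  have hDint : ∀ g : Γ, ∫ x, ‖ζ (g⁻¹ • x) - w (g⁻¹ • x)‖ ∂μ ≤ ε := fun g => by
    have h1 : ∫ x, ‖ζ (g⁻¹ • x) - w (g⁻¹ • x)‖ ∂μ = ∫ x, ‖ζ x - w x‖ ∂μ :=
      (measurePreserving_smul g⁻¹ μ).integral_comp (measurableEmbedding_const_smul g⁻¹)
        (fun x => ‖ζ x - w x‖)
    rw [h1]
    exact integral_norm_le_of_eLpNorm_le hD hε hd
  calc _ ≤ ∫ x, (|u x - G fun g => ζ (g⁻¹ • x)| +
        L * ∑ g ∈ F, ‖ζ (g⁻¹ • x) - w (g⁻¹ • x)‖) ∂μ := by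
        refine integral_mono hu'.abs
          (hu.abs.add ((integrable_finsetSum _ fun g _ => hDi g).const_mul L)) fun x => ?_
        have e : u x - (G fun g => w (g⁻¹ • x)) = (u x - G fun g => ζ (g⁻¹ • x)) +
          ((G fun g => ζ (g⁻¹ • x)) - G fun g => w (g⁻¹ • x)) := by ring
        dsimp only
        rw [e]
        exact (abs_add_le _ _).trans (by gcongr; exact hG _ _)
    _ = ∫ x, |u x - G fun g => ζ (g⁻¹ • x)| ∂μ +
        L * ∑ g ∈ F, ∫ x, ‖ζ (g⁻¹ • x) - w (g⁻¹ • x)‖ ∂μ := by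
        rw [integral_add hu.abs ((integrable_finsetSum _ fun g _ => hDi g).const_mul L),
          integral_const_mul, integral_finsetSum _ fun g _ => hDi g]
    _ ≤ κ + L * ∑ _g ∈ F, ε := by
        gcongr with g _
        exact hDint g
    _ = _ := by rw [Finset.sum_const, nsmul_eq_mul, mul_assoc]

end Koopman

/-! ## Singular functions generate factors of entropy at most zero -/

theorem CylinderLipschitz.congr {ι : Type*} {F : Finset ι} {L : ℝ} {G : (ι → ℂ) → ℝ}
    (hG : CylinderLipschitz F L G) {z z' : ι → ℂ} (h : ∀ i ∈ F, z i = z' i) : G z = G z' := by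
  have h1 := hG z z'
  rw [Finset.sum_eq_zero fun i hi => by rw [h i hi, sub_self, norm_zero], mul_zero] at h1
  exact sub_eq_zero.1 (abs_nonpos_iff.1 h1)

section

variable {Γ X : Type*} [Group Γ] [MeasurableSpace X] [MulAction Γ X] [MeasurableConstSMul Γ X]

/-- Each level set of `α` is pulled back from the space of orbits of `ζ`, where cylinder
approximation applies to the law of the orbit. -/
theorem exists_cylinderLipschitz_approx (μ : Measure X) [IsProbabilityMeasure μ] {ζ : X → ℂ}
    (hζm : Measurable ζ)
    (hgen : ∀ E : Set X, MeasurableSet E → ∃ E' : Set (Γ → ℂ), MeasurableSet E' ∧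
      E = (fun x g => ζ (g⁻¹ • x)) ⁻¹' E')
    {k : ℕ} {α : X → Fin k} (hα : Measurable α) (i : Fin k) {κ : ℝ} (hκ : 0 < κ) :
    ∃ (F : Finset Γ) (L : ℝ) (G : (Γ → ℂ) → ℝ), 0 ≤ L ∧ CylinderLipschitz F L G ∧ Measurable G ∧
      Integrable (fun x => (if α x = i then (1 : ℝ) else 0) - G fun g => ζ (g⁻¹ • x)) μ ∧
      ∫ x, |(if α x = i then (1 : ℝ) else 0) - G fun g => ζ (g⁻¹ • x)| ∂μ ≤ κ := by
  have hz : Measurable fun x (g : Γ) => ζ (g⁻¹ • x) :=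
    measurable_pi_lambda _ fun g => hζm.comp (measurable_const_smul g⁻¹)
  obtain ⟨E', hE', hE⟩ := hgen (α ⁻¹' {i}) (hα (measurableSet_singleton i))
  have := Measure.isProbabilityMeasure_map (μ := μ) hz.aemeasurable
  obtain ⟨F, L, G, hL, hG, hGm, hint⟩ := isCylinderApproximable_of_measurableSet
    (μ.map fun x (g : Γ) => ζ (g⁻¹ • x)) hE' (ENNReal.ofReal κ) (by simpa using hκ)
  have hind : Measurable (E'.indicator fun _ => (1 : ℝ)) := measurable_const.indicator hE'
  rw [lintegral_map (by fun_prop) hz] at hint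
  have hae : ∀ x, E'.indicator (fun _ => (1 : ℝ)) (fun g => ζ (g⁻¹ • x)) =
      if α x = i then 1 else 0 := by
    intro x
    have h1 : α x = i ↔ (fun g => ζ (g⁻¹ • x)) ∈ E' := by
      have : x ∈ α ⁻¹' {i} ↔ x ∈ (fun x g => ζ (g⁻¹ • x)) ⁻¹' E' := by rw [hE]
      exact this
    by_cases h : α x = i
    · rw [if_pos h, Set.indicator_of_mem (h1.1 h)]
    · rw [if_neg h, Set.indicator_of_notMem fun h2 => h (h1.2 h2)]
  simp only [hae] at hint
  have hm : Measurable fun x => (if α x = i then (1 : ℝ) else 0) - G fun g => ζ (g⁻¹ • x) := by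
    have h1 := (hind.comp hz).sub (hGm.comp hz)
    convert h1 using 1
    ext x
    simp only [Pi.sub_apply, Function.comp_apply, hae]
  have hen : ∀ x, ENNReal.ofReal |(if α x = i then (1 : ℝ) else 0) - G fun g => ζ (g⁻¹ • x)| =
      ‖(if α x = i then (1 : ℝ) else 0) - G fun g => ζ (g⁻¹ • x)‖ₑ := fun x => by
    rw [← Real.norm_eq_abs, ofReal_norm]
  simp only [hen] at hint
  have hi : Integrable (fun x => (if α x = i then (1 : ℝ) else 0) - G fun g => ζ (g⁻¹ • x)) μ :=
    ⟨hm.aestronglyMeasurable, lt_of_le_of_lt hint ENNReal.ofReal_lt_top⟩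
  refine ⟨F, L, G, hL, hG, hGm, hi, ?_⟩
  rw [← ofReal_integral_norm_eq_lintegral_enorm hi, ENNReal.ofReal_le_ofReal_iff hκ.le] at hint
  exact hint

end

namespace SoficEntropy

variable {Γ X : Type*} [Group Γ] [MeasurableSpace X] [MulAction Γ X] [MeasurableConstSMul Γ X]

theorem log_natCast_div_le {N d : ℕ} {η : ℝ} (hd : 0 < d) (h : (N : ℝ) ≤ Real.exp (η * d)) :
    ENNReal.log (N : ℝ≥0∞) / ((d : ℝ) : EReal) ≤ (η : EReal) := by
  have hd0 : (0 : ℝ) < d := by exact_mod_cast hd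
  rw [EReal.div_le_iff_le_mul (by exact_mod_cast hd0) (EReal.coe_ne_top _)]
  have h1 : (N : ℝ≥0∞) ≤ ENNReal.ofReal (Real.exp (η * d)) := by
    rw [← ENNReal.ofReal_natCast]
    exact ENNReal.ofReal_le_ofReal h
  refine (ENNReal.log_monotone h1).trans ?_
  rw [ENNReal.log_ofReal_of_pos (Real.exp_pos _), Real.log_exp, ← EReal.coe_mul, mul_comm]

open Classical in
/-- The family `v ∘ a`, extended by zero outside of `F`. -/
noncomputable def extendValues {m : ℕ} (v : Fin m → ℂ) {F : Finset Γ} (a : F → Fin m) (g : Γ) : ℂ :=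
  if h : g ∈ F then v (a ⟨g, h⟩) else 0

theorem extendValues_of_mem {Γ : Type*} {m : ℕ} (v : Fin m → ℂ) {F : Finset Γ} (a : F → Fin m)
    {g : Γ} (h : g ∈ F) : extendValues v a g = v (a ⟨g, h⟩) := dif_pos h

/-- Good microstates, for a suitable choice of `β`, `F` and `δ`, give vectors that are bounded,
almost fixed by the operator of `f`, and almost determine the labels through `G`. -/
theorem exists_microstates_control (μ : Measure X) [IsProbabilityMeasure μ]
    [SMulInvariantMeasure Γ X μ] {ζ : X → ℂ} (hζ : MemLp ζ 2 μ) {k : ℕ} {α : X → Fin k}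
    (hα : Measurable α) {Fs : Fin k → Finset Γ} {L : Fin k → ℝ} {G : Fin k → (Γ → ℂ) → ℝ}
    (hL : ∀ i, 0 ≤ L i) (hG : ∀ i, CylinderLipschitz (Fs i) (L i) (G i)) {κ : ℝ} (hκ : 0 < κ)
    (hGint : ∀ i, Integrable
      (fun x => (if α x = i then (1 : ℝ) else 0) - G i fun g => ζ (g⁻¹ • x)) μ)
    (hGle : ∀ i, ∫ x, |(if α x = i then (1 : ℝ) else 0) - G i fun g => ζ (g⁻¹ • x)| ∂μ ≤ κ / 4)
    {R : ℝ} (hR : 1 ≤ R) (hζR : eLpNorm ζ 2 μ ≤ ENNReal.ofReal (R - 1)) (f : Γ →₀ ℂ) {ε : ℝ}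
    (hε : 0 < ε)
    (hf : eLpNorm (fun x => ∑ g ∈ f.support, f g * ζ (g⁻¹ • x) - ζ x) 2 μ ≤
      ENNReal.ofReal (ε / 2)) :
    ∃ (m : ℕ) (β : X → Fin m) (pr : Fin m → Fin k) (v : Fin m → ℂ) (F : Finset Γ)
      (hF : (1 : Γ) ∈ F) (δ : ℝ), Measurable β ∧ (∀ x, pr (β x) = α x) ∧ 0 < δ ∧
      ∀ (d : ℕ) (σ : Γ → Equiv.Perm (Fin d)), ∀ φ ∈ AP μ β F hF δ σ,
        let c : EuclideanSpace ℂ (Fin d) := WithLp.toLp 2 fun j => v (φ j ⟨1, hF⟩)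
        ‖c‖ ≤ R * √d ∧ ‖c - soficOperator σ f c‖ ≤ ε * √d ∧
        ∀ i, ∑ j, |(if pr (φ j ⟨1, hF⟩) = i then (1 : ℝ) else 0) -
          G i fun g => c ((σ g)⁻¹ j)| ≤ κ * d := by
  classical
  have hS : 0 ≤ ∑ g ∈ f.support, ‖f g‖ := Finset.sum_nonneg fun _ _ => norm_nonneg _
  have hLF : ∀ i, 0 ≤ L i * (Fs i).card := fun i => mul_nonneg (hL i) (Nat.cast_nonneg _)
  have hLS : 0 ≤ ∑ i, L i * (Fs i).card := Finset.sum_nonneg fun i _ => hLF i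
  -- The `L²` error `ε'` of replacing `ζ` by `v ∘ β` must leave a strict margin in three bounds: `R
  -- - 1 + ε' < R`, `ε / 2 + ε / 4 < ε` and `κ / 4 + κ / 4 < κ`.
  obtain ⟨ε', hε', h1, h2, h3⟩ : ∃ ε' : ℝ, 0 < ε' ∧ ε' ≤ 1 / 2 ∧
      (∑ g ∈ f.support, ‖f g‖ + 1) * ε' ≤ ε / 4 ∧ ∀ i, L i * (Fs i).card * ε' ≤ κ / 4 := by
    refine ⟨min (1 / 2) (min (ε / 4 / (∑ g ∈ f.support, ‖f g‖ + 1))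
      (κ / 4 / (∑ i, L i * (Fs i).card + 1))), by positivity, min_le_left _ _, ?_, fun i => ?_⟩
    · rw [← le_div_iff₀' (by positivity)]
      exact (min_le_right _ _).trans (min_le_left _ _)
    · calc _ ≤ (∑ i, L i * (Fs i).card + 1) * (κ / 4 / (∑ i, L i * (Fs i).card + 1)) := by
            gcongr
            · have := Finset.single_le_sum (f := fun i => L i * ((Fs i).card : ℝ))
                (fun i _ => hLF i) (Finset.mem_univ i)
              linarith
            · exact (min_le_right _ _).trans (min_le_right _ _)
        _ = κ / 4 := by field_simp
  obtain ⟨m, β, pr, v, hβ, hpr, hβζ⟩ := exists_refinement hζ hα hε'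
  let w : X → ℂ := fun x => v (β x)
  have hwm : Measurable w := (measurable_of_finite v).comp hβ
  have hw : MemLp w 2 μ := by
    refine MemLp.of_bound hwm.aestronglyMeasurable (∑ b, ‖v b‖) (Eventually.of_forall fun x => ?_)
    exact Finset.single_le_sum (f := fun b => ‖v b‖) (fun _ _ => norm_nonneg _)
      (Finset.mem_univ (β x))
  let F : Finset Γ := insert 1 (f.support ∪ Finset.univ.biUnion Fs)
  have hF : (1 : Γ) ∈ F := Finset.mem_insert_self _ _
  have hfF : ∀ g ∈ f.support, g ∈ F := fun g hg =>
    Finset.mem_insert_of_mem (Finset.mem_union_left _ hg)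
  have hFsF : ∀ i, ∀ g ∈ Fs i, g ∈ F := fun i g hg =>
    Finset.mem_insert_of_mem (Finset.mem_union_right _
      (Finset.mem_biUnion.2 ⟨i, Finset.mem_univ _, hg⟩))
  have hext : ∀ x, ∀ g ∈ F, extendValues v (itinerary β F x) g = w (g⁻¹ • x) := fun x g hg =>
    extendValues_of_mem v _ hg
  -- The three conclusions are empirical averages of `H₁`, `H₂`, `H₃`: squared norm, squared defect
  -- of being fixed, and labelling error. Their integrals have room to spare, so a small `δ`
  -- suffices for all.
  let H₁ : Fin m → (F → Fin m) → ℝ := fun b _ => ‖v b‖ ^ 2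
  let H₂ : Fin m → (F → Fin m) → ℝ := fun b a =>
    ‖∑ g ∈ f.support, f g * extendValues v a g - v b‖ ^ 2
  let H₃ : Fin k → Fin m → (F → Fin m) → ℝ := fun i b a =>
    |(if pr b = i then (1 : ℝ) else 0) - G i (extendValues v a)|
  have hI₁ : ∫ x, H₁ (β x) (itinerary β F x) ∂μ < R ^ 2 := by
    have hw1 : eLpNorm w 2 μ ≤ ENNReal.ofReal (R - 1 + ε') := by
      have e : w = ζ - fun x => ζ x - w x := by ext x; simp
      rw [e, ENNReal.ofReal_add (by linarith) hε'.le]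
      exact (eLpNorm_sub_le hζ.1 (hζ.sub hw).1 (by norm_num)).trans (add_le_add hζR hβζ)
    refine (integral_norm_sq_le_of_eLpNorm_le hw (by linarith) hw1).trans_lt ?_
    exact pow_lt_pow_left₀ (by linarith) (by linarith) two_ne_zero
  have hI₂ : ∫ x, H₂ (β x) (itinerary β F x) ∂μ < ε ^ 2 := by
    have e : ∀ x, H₂ (β x) (itinerary β F x) =
        ‖∑ g ∈ f.support, f g * w (g⁻¹ • x) - w x‖ ^ 2 := by
      intro x
      simp only [H₂]
      congr 3
      exact Finset.sum_congr rfl fun g hg => by rw [hext x g (hfF g hg)]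
    simp only [e]
    refine (integral_norm_groupAlgebra_sub_sq_le hζ hw f (by positivity) hε'.le hf hβζ).trans_lt ?_
    exact pow_lt_pow_left₀ (by linarith) (by positivity) two_ne_zero
  have hI₃ : ∀ i, ∫ x, H₃ i (β x) (itinerary β F x) ∂μ < κ := by
    intro i
    have e : ∀ x, (if pr (β x) = i then (1 : ℝ) else 0) - G i (extendValues v (itinerary β F x)) =
        (if α x = i then (1 : ℝ) else 0) - G i fun g => w (g⁻¹ • x) := by
      intro x
      rw [hpr x, (hG i).congr fun g hg => hext x g (hFsF i g hg)]
    have hint : Integrable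
        (fun x => (if α x = i then (1 : ℝ) else 0) - G i fun g => w (g⁻¹ • x)) μ := by
      simp only [← e]
      let h : Fin m × (F → Fin m) → ℝ := fun p =>
        (if pr p.1 = i then (1 : ℝ) else 0) - G i (extendValues v p.2)
      have hm : Measurable fun x => (β x, itinerary β F x) :=
        hβ.prodMk (measurable_itinerary hβ F)
      refine Integrable.of_bound ((measurable_of_finite h).comp hm).aestronglyMeasurable
        (∑ p, ‖h p‖) (Eventually.of_forall fun x => ?_)
      exact Finset.single_le_sum (f := fun p => ‖h p‖) (fun _ _ => norm_nonneg _)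
        (Finset.mem_univ (β x, itinerary β F x))
    simp only [H₃, e]
    have := integral_abs_indicator_sub_le hζ hw (hL i) (hG i) (hGint i) hint hε'.le (hGle i) hβζ
    linarith [h3 i]
  have hev := ((eventually_sum_le_of_mem_AP μ hβ F hF H₁ hI₁).and
    ((eventually_sum_le_of_mem_AP μ hβ F hF H₂ hI₂).and
    (eventually_all.2 fun i => eventually_sum_le_of_mem_AP μ hβ F hF (H₃ i) (hI₃ i)))).and
    (self_mem_nhdsWithin (a := (0 : ℝ)) (s := Set.Ioi 0))
  obtain ⟨δ, ⟨hδ₁, hδ₂, hδ₃⟩, hδ⟩ := hev.exists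
  refine ⟨m, β, pr, v, F, hF, δ, hβ, hpr, hδ, fun d σ φ hφ => ?_⟩
  intro c
  have hcext : ∀ j, ∀ g ∈ F, extendValues v (fun g : F => φ ((σ g)⁻¹ j) ⟨1, hF⟩) g =
      c ((σ g)⁻¹ j) := fun j g hg => extendValues_of_mem v _ hg
  have hsq : ∀ (x : EuclideanSpace ℂ (Fin d)) (t : ℝ), 0 ≤ t → ∑ j, ‖x j‖ ^ 2 ≤ t ^ 2 * d →
      ‖x‖ ≤ t * √d := by
    intro x t ht h
    refine (sq_le_sq₀ (norm_nonneg _) (by positivity)).1 ?_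
    rwa [EuclideanSpace.norm_sq_eq, mul_pow, Real.sq_sqrt (Nat.cast_nonneg d)]
  refine ⟨hsq _ _ (by linarith) (hδ₁ d σ φ hφ), ?_, fun i => ?_⟩
  · rw [norm_sub_rev]
    refine hsq _ _ hε.le (le_of_eq_of_le (Finset.sum_congr rfl fun j _ => ?_) (hδ₂ d σ φ hφ))
    simp only [H₂]
    rw [PiLp.sub_apply, soficOperator_apply]
    congr 3
    exact Finset.sum_congr rfl fun g hg => by rw [hcext j g (hfF g hg)]
  · refine le_of_eq_of_le (Finset.sum_congr rfl fun j _ => ?_) (hδ₃ i d σ φ hφ)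
    simp only [H₃]
    rw [(hG i).congr fun g hg => hcext j g (hFsF i g hg)]

/-- The order of choices matters: the Hamming radius `θ` and the cylinder functions come from `ζ`
and `α` alone, then `r`, `R`, `τ`, then `f` by singularity, and only then `β`, `F`, `δ`. Thus the
Lipschitz constants that fix the scale `r` do not depend on how finely `β` resolves `ζ`. -/
theorem hObs_le_zero (S : SoficApproximation Γ) (μ : Measure X) [IsProbabilityMeasure μ]
    [SMulInvariantMeasure Γ X μ] {ζ : X → ℂ} (hζm : Measurable ζ) (hζ : MemLp ζ 2 μ)
    (hgen : ∀ E : Set X, MeasurableSet E → ∃ E' : Set (Γ → ℂ), MeasurableSet E' ∧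
      E = (fun x g => ζ (g⁻¹ • x)) ⁻¹' E')
    (hsing : IsSingularFunction Γ μ ζ) {k : ℕ} {α : X → Fin k} (hα : Measurable α) :
    hObs S μ α ≤ 0 := by
  suffices h : ∀ η : ℝ, 0 < η → hObs S μ α ≤ ((2 * η : ℝ) : EReal) by
    by_contra! hpos
    obtain ⟨t, ht0, ht⟩ := EReal.lt_iff_exists_real_btwn.1 hpos
    have ht0' : 0 < t := by exact_mod_cast ht0
    have := h (t / 2) (by positivity)
    rw [mul_div_cancel₀ _ two_ne_zero] at this
    exact absurd ht (not_lt.2 this)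
  intro η hη
  obtain ⟨θ, hθ, hball⟩ := exists_card_hammingBall_le k hη
  -- The labelling error and the distance between vectors each use half of the Hamming radius `θ`,
  -- through `κ` and `r`.
  set κ := θ / (4 * (k + 1)) with hκdef
  have hκ : 0 < κ := by positivity
  choose Fs L G hL hG _ hGint hGle using fun i : Fin k =>
    exists_cylinderLipschitz_approx μ hζm hgen hα i (κ := κ / 4) (by positivity)
  have hLS : 0 ≤ ∑ i, L i * (Fs i).card :=
    Finset.sum_nonneg fun i _ => mul_nonneg (hL i) (Nat.cast_nonneg _)
  set r := θ / (2 * (1 + ∑ i, L i * (Fs i).card)) with hrdef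
  have hr : 0 < r := by positivity
  have hθr : k * (2 * κ) + r * ∑ i, L i * (Fs i).card ≤ θ := by
    have h1 : k * (2 * κ) ≤ θ / 2 := by
      rw [hκdef, mul_div_assoc', mul_div_assoc', div_le_div_iff₀ (by positivity) (by norm_num)]
      nlinarith
    have h2 : r * ∑ i, L i * (Fs i).card ≤ θ / 2 := by
      rw [hrdef, div_mul_eq_mul_div, div_le_div_iff₀ (by positivity) (by norm_num)]
      nlinarith
    linarith
  set R := (eLpNorm ζ 2 μ).toReal + 1 with hRdef
  have hR : 1 ≤ R := by rw [hRdef]; linarith [ENNReal.toReal_nonneg (a := eLpNorm ζ 2 μ)]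
  have hR0 : 0 < R := by linarith
  have hζR : eLpNorm ζ 2 μ ≤ ENNReal.ofReal (R - 1) := by
    rw [hRdef, add_sub_cancel_right, ENNReal.ofReal_toReal hζ.2.ne]
  have hlog : 0 ≤ Real.log (1 + 4 * R / r) :=
    Real.log_nonneg (by linarith [show 0 ≤ 4 * R / r by positivity])
  -- Solves the requirement `hτ` on the Hilbert–Schmidt norm; adding 1 to the logarithm keeps the
  -- denominator positive.
  set τ := η * (r / (8 * R)) ^ 2 / (2 * (1 + Real.log (1 + 4 * R / r))) with hτdef
  have hτ0 : 0 < τ := by positivity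
  have hτ : 2 * (τ / (r / (8 * R)) ^ 2) * Real.log (1 + 4 * R / r) ≤ η := by
    have h1 : 2 * (τ / (r / (8 * R)) ^ 2) = η / (1 + Real.log (1 + 4 * R / r)) := by
      rw [hτdef]; field_simp
    rw [h1, div_mul_eq_mul_div, div_le_iff₀ (by positivity)]
    nlinarith
  obtain ⟨f, hf, hf2⟩ := hsing (min (√τ) (r / 8 / 2)) (by positivity)
  have hfτ : ∑ g ∈ f.support, ‖f g‖ ^ 2 < τ := by
    refine hf2.trans_le ?_
    calc _ ≤ √τ ^ 2 := by
          gcongr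
          exact min_le_left _ _
      _ = τ := Real.sq_sqrt hτ0.le
  obtain ⟨m, β, pr, v, F, hF, δ, hβ, hpr, hδ, hctrl⟩ := exists_microstates_control μ hζ hα hL hG hκ
    hGint hGle hR hζR f (ε := r / 8) (by positivity)
    (hf.trans (ENNReal.ofReal_le_ofReal (min_le_right _ _)))
  refine iInf_le_of_le m <| iInf_le_of_le β <| iInf_le_of_le hβ <| iInf_le_of_le pr <|
    iInf_le_of_le (Eventually.of_forall hpr) <| iInf_le_of_le F <| iInf_le_of_le hF <|
    iInf_le_of_le δ <| iInf_le_of_le hδ ?_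
  refine limsup_le_of_le (by isBoundedDefault) ?_
  filter_upwards [S.eventually_d_pos, S.eventually_hilbertSchmidt_le f hfτ] with i hd hHS
  refine log_natCast_div_le hd ?_
  set A₀ := (fun (φ : Fin (S.d i) → (F → Fin m)) j => pr (φ j ⟨1, hF⟩)) ''
    AP μ β F hF δ (S.σ i) with hA₀
  have hfin : A₀.Finite := Set.toFinite _
  rw [Set.ncard_eq_toFinset_card A₀ hfin]
  rcases A₀.eq_empty_or_nonempty with hA | ⟨a₀, φ₀, -⟩
  · have : hfin.toFinset = ∅ := by rw [Set.Finite.toFinset_eq_empty, hA]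
    rw [this, Finset.card_empty, Nat.cast_zero]
    exact (Real.exp_pos _).le
  -- Pick a microstate over each realized labelling; `φ₀` is an irrelevant value elsewhere.
  have hpre : ∀ a : Fin (S.d i) → Fin k, ∃ φ : Fin (S.d i) → (F → Fin m), a ∈ A₀ →
      φ ∈ AP μ β F hF δ (S.σ i) ∧ (fun j => pr (φ j ⟨1, hF⟩)) = a := by
    intro a
    by_cases ha : a ∈ A₀
    · obtain ⟨φ, hφ⟩ := ha
      exact ⟨φ, fun _ => hφ⟩
    · exact ⟨φ₀, fun h => absurd h ha⟩
  choose φ hφ using hpre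
  refine card_le_exp_of_almost_fixed hd (S.σ i) (soficOperator (S.σ i) f) hL hG hr hR0 hθr
    (hball _) hτ hHS hfin.toFinset
    (fun a => WithLp.toLp 2 fun j => v (φ a j ⟨1, hF⟩)) ?_ ?_ ?_
  · intro a ha
    exact (hctrl _ _ _ (hφ a (hfin.mem_toFinset.1 ha)).1).1
  · intro a ha
    exact (hctrl _ _ _ (hφ a (hfin.mem_toFinset.1 ha)).1).2.1
  · intro a ha
    obtain ⟨h1, h2⟩ := hφ a (hfin.mem_toFinset.1 ha)
    have h3 := (hctrl _ _ _ h1).2.2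
    intro i'
    have h4 : ∀ j, pr (φ a j ⟨1, hF⟩) = a j := fun j => congrFun h2 j
    simpa only [h4] using h3 i'

/-- If the translates of a singular square-integrable function generate the σ-algebra, the sofic
entropy is at most zero. -/
theorem entropy_le_zero (S : SoficApproximation Γ) (μ : Measure X) [IsProbabilityMeasure μ]
    [SMulInvariantMeasure Γ X μ] {ζ : X → ℂ} (hζm : Measurable ζ) (hζ : MemLp ζ 2 μ)
    (hgen : ∀ E : Set X, MeasurableSet E → ∃ E' : Set (Γ → ℂ), MeasurableSet E' ∧
      E = (fun x g => ζ (g⁻¹ • x)) ⁻¹' E')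
    (hsing : IsSingularFunction Γ μ ζ) : entropy S μ ≤ 0 :=
  iSup_le fun _ => iSup_le fun _ => iSup_le fun hα => hObs_le_zero S μ hζm hζ hgen hsing hα

end SoficEntropy

/-! ## The factor generated by a function -/

/-- The space of complex functions on the countable group `Γ`, in the lowest universe. -/
def ShiftSpace (Γ : Type*) [Countable Γ] : Type := Shrink.{0} Γ → ℂ

namespace ShiftSpace

variable {Γ : Type*} [Countable Γ]

noncomputable instance : MeasurableSpace (ShiftSpace Γ) :=
  inferInstanceAs (MeasurableSpace (Shrink.{0} Γ → ℂ))

instance : StandardBorelSpace (ShiftSpace Γ) :=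
  haveI : Countable (Shrink.{0} Γ) := (equivShrink.{0} Γ).symm.injective.countable
  inferInstanceAs (StandardBorelSpace (Shrink.{0} Γ → ℂ))

/-- The value of a point of the shift space at `g`. -/
noncomputable def coord (g : Γ) (y : ShiftSpace Γ) : ℂ := y (equivShrink.{0} Γ g)

/-- The point of the shift space with given values. -/
noncomputable def ofFun (z : Γ → ℂ) : ShiftSpace Γ := fun s => z ((equivShrink.{0} Γ).symm s)

@[simp] theorem coord_ofFun (z : Γ → ℂ) (g : Γ) : coord g (ofFun z) = z g := by
  simp [coord, ofFun]

@[simp] theorem ofFun_coord (y : ShiftSpace Γ) : ofFun (fun g => coord g y) = y := by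
  funext s
  simp [coord, ofFun]

theorem measurable_coord (g : Γ) : Measurable (coord g : ShiftSpace Γ → ℂ) :=
  measurable_pi_apply (X := fun _ : Shrink.{0} Γ => ℂ) _

theorem measurable_ofFun : Measurable (ofFun : (Γ → ℂ) → ShiftSpace Γ) :=
  measurable_pi_lambda (X := fun _ : Shrink.{0} Γ => ℂ) _ fun _ => measurable_pi_apply _

variable [Group Γ]

noncomputable instance : MulAction Γ (ShiftSpace Γ) where
  smul g y := ofFun fun h => coord (g⁻¹ * h) y
  one_smul y := by
    change ofFun (fun h => coord (1⁻¹ * h) y) = y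
    simp
  mul_smul g g' y := by
    change ofFun (fun h => coord ((g * g')⁻¹ * h) y) =
      ofFun (fun h => coord (g⁻¹ * h) (ofFun fun h => coord (g'⁻¹ * h) y))
    simp [mul_assoc]

theorem smul_def (g : Γ) (y : ShiftSpace Γ) : g • y = ofFun fun h => coord (g⁻¹ * h) y := rfl

theorem coord_one_inv_smul (g : Γ) (y : ShiftSpace Γ) : coord 1 (g⁻¹ • y) = coord g y := by
  simp [smul_def]

instance : MeasurableConstSMul Γ (ShiftSpace Γ) where
  measurable_const_smul g :=
    measurable_ofFun.comp (measurable_pi_lambda _ fun h => measurable_coord (g⁻¹ * h))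

variable {X : Type*} [MulAction Γ X]

/-- The equivariant map to the shift space given by the translates of a function. -/
noncomputable def orbit (Γ : Type*) [Countable Γ] [Group Γ] [MulAction Γ X] (ζ : X → ℂ) (x : X) :
    ShiftSpace Γ :=
  ofFun fun g => ζ (g⁻¹ • x)

theorem orbit_smul (ζ : X → ℂ) (g : Γ) (x : X) : orbit Γ ζ (g • x) = g • orbit Γ ζ x := by
  simp [orbit, smul_def, mul_smul]

theorem coord_orbit (ζ : X → ℂ) (g : Γ) (x : X) : coord g (orbit Γ ζ x) = ζ (g⁻¹ • x) := by
  simp [orbit]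

variable [MeasurableSpace X] [MeasurableConstSMul Γ X]

theorem measurable_orbit {ζ : X → ℂ} (hζ : Measurable ζ) : Measurable (orbit Γ ζ) :=
  measurable_ofFun.comp (measurable_pi_lambda _ fun g => hζ.comp (measurable_const_smul g⁻¹))

theorem smulInvariantMeasure_map_orbit (μ : Measure X) [SMulInvariantMeasure Γ X μ] {ζ : X → ℂ}
    (hζ : Measurable ζ) : SMulInvariantMeasure Γ (ShiftSpace Γ) (μ.map (orbit Γ ζ)) := by
  refine ⟨fun g s hs => ?_⟩
  have h1 := measurable_orbit (Γ := Γ) hζ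
  rw [Measure.map_apply h1 (measurable_const_smul g hs), Measure.map_apply h1 hs]
  have h2 : orbit Γ ζ ⁻¹' ((fun y => g • y) ⁻¹' s) = (fun x => g • x) ⁻¹' (orbit Γ ζ ⁻¹' s) := by
    ext x
    simp only [Set.mem_preimage, orbit_smul]
  rw [h2]
  exact SMulInvariantMeasure.measure_preimage_smul g (h1 hs)

theorem isSingularFunction_map_orbit {μ : Measure X} {ζ : X → ℂ} (hζ : Measurable ζ)
    (h : IsSingularFunction Γ μ ζ) :
    IsSingularFunction Γ (μ.map (orbit Γ ζ)) (coord (1 : Γ)) := by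
  intro ε hε
  obtain ⟨f, hf, hf2⟩ := h ε hε
  refine ⟨f, ?_, hf2⟩
  simp only [coord_one_inv_smul]
  have hm : Measurable fun y : ShiftSpace Γ => ∑ g ∈ f.support, f g * coord g y - coord 1 y :=
    (Finset.measurable_sum _ fun g _ => (measurable_coord g).const_mul (f g)).sub
      (measurable_coord 1)
  rw [eLpNorm_map_measure hm.aestronglyMeasurable (measurable_orbit hζ).aemeasurable]
  simpa only [Function.comp_def, coord_orbit, inv_one, one_smul] using hf

end ShiftSpace

/-- In an action with completely positive entropy, singular functions are almost everywhere
constant. -/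
theorem HasCompletelyPositiveEntropy.ae_eq_const_of_isSingularFunction {Γ X : Type*} [Group Γ]
    [Countable Γ] {S : SoficApproximation Γ} [MeasurableSpace X] [MulAction Γ X]
    [MeasurableConstSMul Γ X] {μ : Measure X} [IsProbabilityMeasure μ]
    [SMulInvariantMeasure Γ X μ] (hcpe : HasCompletelyPositiveEntropy S μ) {ζ : X → ℂ}
    (hζm : Measurable ζ) (hζ : MemLp ζ 2 μ) (hsing : IsSingularFunction Γ μ ζ) :
    ∃ c : ℂ, ζ =ᵐ[μ] fun _ => c := by
  by_contra! hne
  have hΦ := ShiftSpace.measurable_orbit (Γ := Γ) hζm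
  have := Measure.isProbabilityMeasure_map (μ := μ) hΦ.aemeasurable
  have := ShiftSpace.smulInvariantMeasure_map_orbit (Γ := Γ) μ hζm
  refine absurd (hcpe (ShiftSpace Γ) (μ.map (ShiftSpace.orbit Γ ζ))
    ⟨ShiftSpace.orbit Γ ζ, ⟨hΦ, rfl⟩, fun g => Eventually.of_forall fun x =>
      ShiftSpace.orbit_smul ζ g x⟩ ?_) (not_lt.2 ?_)
  -- If the factor is a point mass at `y`, its coordinate at the identity, which pulls back to `ζ`,
  -- is almost everywhere constant.
  · intro y hy
    refine hne (ShiftSpace.coord 1 y) ?_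
    have hs : MeasurableSet {y' : ShiftSpace Γ | ShiftSpace.coord 1 y' = ShiftSpace.coord 1 y} :=
      ShiftSpace.measurable_coord 1 (measurableSet_singleton _)
    have h1 : ∀ᵐ y' ∂(μ.map (ShiftSpace.orbit Γ ζ)),
        ShiftSpace.coord 1 y' = ShiftSpace.coord 1 y := by
      rw [hy, ae_dirac_iff hs]
    rw [ae_map_iff hΦ.aemeasurable hs] at h1
    filter_upwards [h1] with x hx
    rw [← hx, ShiftSpace.coord_orbit, inv_one, one_smul]
  · refine SoficEntropy.entropy_le_zero S _ (ShiftSpace.measurable_coord 1) ?_ ?_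
      (ShiftSpace.isSingularFunction_map_orbit hζm hsing)
    · rw [memLp_map_measure_iff (ShiftSpace.measurable_coord 1).aestronglyMeasurable
        hΦ.aemeasurable]
      simpa only [Function.comp_def, ShiftSpace.coord_orbit, inv_one, one_smul] using hζ
    -- The translates of `coord 1` are all the coordinates, so they recover a point through `ofFun`
    -- and generate the σ-algebra.
    · intro E hE
      refine ⟨ShiftSpace.ofFun ⁻¹' E, ShiftSpace.measurable_ofFun hE, ?_⟩
      ext y
      simp only [Set.mem_preimage, ShiftSpace.coord_one_inv_smul, ShiftSpace.ofFun_coord]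

/-! ### Singular vectors of the Koopman representation as functions -/

namespace UnitaryRep

theorem coe_koopman_apply {Γ X : Type*} [Group Γ] [MeasurableSpace X] [MulAction Γ X]
    [MeasurableConstSMul Γ X] (μ : Measure X) [IsFiniteMeasure μ] [SMulInvariantMeasure Γ X μ]
    (g : Γ) (ξ : L2Zero μ) : (koopman Γ μ g ξ : Lp ℂ 2 μ) = koopmanFull Γ μ g ξ := rfl

theorem IsSingularVector.isSingularFunction {Γ X : Type*} [Group Γ] [MeasurableSpace X]
    [MulAction Γ X] [MeasurableConstSMul Γ X] {μ : Measure X} [IsFiniteMeasure μ]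
    [SMulInvariantMeasure Γ X μ] {ξ : L2Zero μ} (h : (koopman Γ μ).IsSingularVector ξ) :
    IsSingularFunction Γ μ (ξ : Lp ℂ 2 μ) := by
  intro ε hε
  obtain ⟨f, hf, hf2⟩ := h ε hε
  refine ⟨f, ?_, hf2⟩
  set w : Lp ℂ 2 μ := ∑ g ∈ f.support, f g • koopmanFull Γ μ g ξ - ξ with hw
  have h1 : ((koopman Γ μ).orbitMap ξ f - ξ : L2Zero μ) = w := by
    rw [orbitMap_apply, hw]
    simp only [AddSubgroupClass.coe_sub, Submodule.coe_sum, Submodule.coe_smul, coe_koopman_apply]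
  have h2 : ‖w‖ < ε := by rw [← h1]; exact hf
  have h3 : w =ᵐ[μ] fun x => ∑ g ∈ f.support, f g * (ξ : Lp ℂ 2 μ) (g⁻¹ • x) -
      (ξ : Lp ℂ 2 μ) x := by
    have hg : ∀ᵐ x ∂μ, ∀ g ∈ f.support, (f g • koopmanFull Γ μ g ξ : Lp ℂ 2 μ) x =
        f g * (ξ : Lp ℂ 2 μ) (g⁻¹ • x) := by
      rw [Finset.eventually_all]
      intro g _
      filter_upwards [Lp.coeFn_smul (f g) (koopmanFull Γ μ g ξ), koopmanFull_ae_eq μ g ξ]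
        with x hx hx'
      rw [hx, Pi.smul_apply, hx', smul_eq_mul]
    filter_upwards [hg, Lp.coeFn_sub (∑ g ∈ f.support, f g • koopmanFull Γ μ g ξ) (ξ : Lp ℂ 2 μ),
      Lp.coeFn_fun_finsetSum f.support fun g => f g • koopmanFull Γ μ g ξ] with x hx hx' hx''
    rw [hw, hx', Pi.sub_apply, hx'']
    congr 1
    exact Finset.sum_congr rfl fun g hg => hx g hg
  rw [← eLpNorm_congr_ae h3, ← Lp.enorm_def, ← ofReal_norm]
  exact ENNReal.ofReal_le_ofReal h2.le

theorem eq_zero_of_mem_L2Zero_of_ae_eq_const {X : Type*} [MeasurableSpace X] {μ : Measure X}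
    [IsFiniteMeasure μ] {ξ : Lp ℂ 2 μ} (hξ : ξ ∈ L2Zero μ) {c : ℂ} (h : ξ =ᵐ[μ] fun _ => c) :
    ξ = 0 := by
  have h1 : ξ = c • Lp.const 2 μ (1 : ℂ) := by
    have h2 : c • Lp.const 2 μ (1 : ℂ) = Lp.const 2 μ c := by
      have := (Lp.constₗ 2 μ ℂ).map_smul c (1 : ℂ)
      simpa using this.symm
    rw [h2]
    exact Lp.ext (h.trans (Lp.coeFn_const 2 μ c).symm)
  have h3 : ξ ∈ Submodule.span ℂ {Lp.const 2 μ (1 : ℂ)} :=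
    h1 ▸ Submodule.smul_mem _ _ (Submodule.mem_span_singleton_self _)
  exact inner_self_eq_zero.1 (Submodule.inner_right_of_mem_orthogonal h3 hξ)

end UnitaryRep

theorem corollary1p2 {Γ X : Type*} [Group Γ] [Countable Γ] (S : SoficApproximation Γ)
    [MeasurableSpace X] [StandardBorelSpace X] [MulAction Γ X] [MeasurableConstSMul Γ X]
    (μ : MeasureTheory.Measure X) [MeasureTheory.IsProbabilityMeasure μ]
    [MeasureTheory.SMulInvariantMeasure Γ X μ]
    (hcpe : HasCompletelyPositiveEntropy S μ) :
    (UnitaryRep.koopman Γ μ).Embeds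
      (UnitaryRep.directSum ℕ (UnitaryRep.leftRegular Γ)) := by
  have : CompleteSpace (UnitaryRep.L2Zero μ) := Submodule.instOrthogonalCompleteSpace _
  -- Finiteness of the exponent, with the countably generated σ-algebra of a standard Borel space,
  -- makes `L²` separable.
  have : Fact ((2 : ℝ≥0∞) ≠ ∞) := ⟨by norm_num⟩
  have : TopologicalSpace.SeparableSpace (UnitaryRep.L2Zero μ) :=
    TopologicalSpace.SecondCountableTopology.to_separableSpace
  refine UnitaryRep.embeds_of_forall_isSingularVector fun ξ hξ => ?_
  obtain ⟨c, hc⟩ := hcpe.ae_eq_const_of_isSingularFunction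
    (Lp.stronglyMeasurable (ξ : Lp ℂ 2 μ)).measurable (Lp.memLp _) hξ.isSingularFunction
  exact Subtype.ext (UnitaryRep.eq_zero_of_mem_L2Zero_of_ae_eq_const ξ.2 hc)
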